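/- Let $(\xi_k)_{k\in\mathbb Z}$ be identically distributed martingale differences adapted to a filtration $(\mathcal F_k)_{k\in\mathbb Z}$ (that is, $\xi_k$ is $\mathcal F_k$-measurable and integrable and $\mathbb E(\xi_k\mid\mathcal F_{k-1})=0$ a.s.), with $\mathbb E\,\xi_0^2=\infty$, and such that $H_0(x)=\mathbb E(\xi_0^2 I(|\xi_0|\le x))$ is slowly varying at $\infty$. Put $b=\inf\{x\ge 0: H_0(x)>1\}$ and $H(x)=H_0(\max(x,b+1))$. Let $(c_{nk})_{1\le k\le m_n}$ be a triangular array of real numbers with $$\sup_n\sum_{k=1}^{m_n}c_{nk}^2H(|c_{nk}|^{-1})<\infty,\qquad \max_{1\le k\le m_n}c_{nk}^2H(|c_{nk}|^{-1})\to 0\quad (n\to\infty),$$ where a term with $c_{nk}=0$ is read as $0$. Assume that one of the following two conditions holds. ($M_1$) There is a sequence of positive numbers $\psi_k\to 0$ such that for all $a,b>0$, all integers $j$ and all $k\ge 1$, $$\operatorname{cov}\bigl(\xi_j^2I(|\xi_j|\le a),\,\xi_{j+k}^2I(|\xi_{j+k}|\le b)\bigr)\le \psi_k\,\mathbb E(\xi_0^2I(|\xi_0|\le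 b))\,\mathbb E(\xi_0^2I(|\xi_0|\le a)).$$ ($M_2$) There is a sequence of positive numbers $\varphi_k$ with $\sum_k\varphi_k<\infty$ such that for all $a,b>0$, all integers $j$ and all $k\ge 1$, $$\operatorname{cov}\bigl(\xi_j^2I(|\xi_j|\le a),\,\xi_{j+k}^2I(|\xi_{j+k}|\le b)\bigr)\le a^2\varphi_k\,\mathbb E(\xi_0^2I(|\xi_0|\le b)).$$ Then $$\sum_{k=1}^{m_n}c_{nk}^2\xi_k^2-\sum_{k=1}^{m_n}c_{nk}^2H(|c_{nk}|^{-1})\to 0\quad\text{in probability.}$$ Consequently, if the array is normalized so that $\sum_{k=1}^{m_n}c_{nk}^2H(|c_{nk}|^{-1})\to 1$, then $\sum_{k=1}^{m_n}c_{nk}^2\xi_k^2\to 1$ in probability, and $\sum_{k=1}^{m_n}c_{nk}\xi_k$ converges in distribution to $N(0,1)$. -/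

import Mathlib

open MeasureTheory ProbabilityTheory Filter Topology

noncomputable section

namespace WeightedCLT

/-- The truncated square `X² · I(|X| ≤ a)`. -/
def truncSq {Ω : Type*} (X : Ω → ℝ) (a : ℝ) : Ω → ℝ :=
  {ω | |X ω| ≤ a}.indicator (fun ω => X ω ^ 2)

/-- The truncated second moment `E (X² I(|X| ≤ x))`. -/
def truncMoment {Ω : Type*} [MeasurableSpace Ω] (μ : Measure Ω) (X : Ω → ℝ) (x : ℝ) : ℝ :=
  ∫ ω, truncSq X x ω ∂μ

/-- The level `b = inf {x ≥ 0 : E (X² I(|X| ≤ x)) > 1}`; the set is nonempty if `E X² = ∞`. -/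
def truncLevel {Ω : Type*} [MeasurableSpace Ω] (μ : Measure Ω) (X : Ω → ℝ) : ℝ :=
  sInf {x : ℝ | 0 ≤ x ∧ 1 < truncMoment μ X x}

/-- The modified function `H(x) = E (X² I(|X| ≤ max(x, b + 1)))`, which is at least `1`
if `E X² = ∞`. -/
def H {Ω : Type*} [MeasurableSpace Ω] (μ : Measure Ω) (X : Ω → ℝ) (x : ℝ) : ℝ :=
  truncMoment μ X (max x (truncLevel μ X + 1))

/-- Slow variation at infinity: eventually positive and `f (l x) / f x → 1` for all `l > 0`. -/
def SlowlyVarying (f : ℝ → ℝ) : Prop :=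
  Measurable f ∧ (∀ᶠ x in atTop, 0 < f x) ∧
    ∀ l : ℝ, 0 < l → Tendsto (fun x => f (l * x) / f x) atTop (𝓝 1)

/-- `ξ` is a sequence of martingale differences adapted to the filtration `ℱ`. -/
structure IsMartingaleDiff {Ω : Type*} {mΩ : MeasurableSpace Ω} (μ : Measure Ω)
    (ℱ : Filtration ℤ mΩ) (ξ : ℤ → Ω → ℝ) : Prop where
  adapted : Adapted ℱ ξ
  integrable : ∀ k, Integrable (ξ k) μ
  condExp_eq_zero : ∀ k, μ[ξ k | ℱ (k - 1)] =ᵐ[μ] 0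

/-- The term `c_{nk}² H(1 / |c_{nk}|)`; it vanishes if `c_{nk} = 0`. -/
def weight {Ω : Type*} [MeasurableSpace Ω] (μ : Measure Ω) (X : Ω → ℝ) (c : ℕ → ℕ → ℝ)
    (n k : ℕ) : ℝ :=
  c n k ^ 2 * H μ X |c n k|⁻¹

/-- The first mixing condition on truncated squares, with coefficients tending to zero. -/
def CondM1 {Ω : Type*} [MeasurableSpace Ω] (μ : Measure Ω) (ξ : ℤ → Ω → ℝ) : Prop :=
  ∃ ψ : ℕ → ℝ, (∀ k, 0 < ψ k) ∧ Tendsto ψ atTop (𝓝 0) ∧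
    ∀ a b : ℝ, 0 < a → 0 < b → ∀ (j : ℤ) (k : ℕ), 1 ≤ k →
      cov[truncSq (ξ j) a, truncSq (ξ (j + k)) b; μ] ≤
        ψ k * truncMoment μ (ξ 0) b * truncMoment μ (ξ 0) a

/-- The second mixing condition on truncated squares, with summable coefficients. -/
def CondM2 {Ω : Type*} [MeasurableSpace Ω] (μ : Measure Ω) (ξ : ℤ → Ω → ℝ) : Prop :=
  ∃ φ : ℕ → ℝ, (∀ k, 0 < φ k) ∧ Summable φ ∧
    ∀ a b : ℝ, 0 < a → 0 < b → ∀ (j : ℤ) (k : ℕ), 1 ≤ k →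
      cov[truncSq (ξ j) a, truncSq (ξ (j + k)) b; μ] ≤
        a ^ 2 * φ k * truncMoment μ (ξ 0) b

end WeightedCLT

end

noncomputable section

namespace WeightedCLT

/-! ### Deterministic inequalities for the characteristic function of a sum. -/

section CharFunBound

/-! Everything is compared with the clipped variables `clip (c * ξ)`, whose squares are `c²` times
`ξ²` truncated at `1 / |c|`. Slow variation of the truncated second moment `H₀` makes `x E(|ξ| I(|ξ|
> x))` of order `o(H₀(x))` and `E(|ξ|³ I(|ξ| ≤ x))` of order `o(x H₀(x))`. Since `H ≥ 1`, vanishing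
weights force vanishing coefficients. So, uniformly along a row, both the clipping error in `L¹` and
the clipped third moment are `o(weight)` (`eventually_clip_bounds`), and their row sums tend to `0`
because the weights have bounded sums.

For the squares, the clipped sum has mean equal to the sum of weights for large `n`. Its variance is
small (`exists_variance_sum_clip_sq_le`): close pairs are controlled by individual variances, which
the clipped third moments dominate, and distant pairs by the mixing condition. Clipping acts only
with small probability, so convergence passes to the original squares.

For the sum itself, the argument is of McLeish type: `exp(itS)` is close to `exp(-t²/2) ∏(1 +
itz_k)`, where the `z_k` are clipped and stopped once the sum of squares exceeds `2`, which keeps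
the product bounded. The martingale property makes the mean of the product nearly `1`. This gives
the non-asymptotic bound `norm_integral_exp_sum_sub_le`, whose three error terms are exactly the
quantities above; Lévy's continuity theorem concludes. -/

lemma norm_one_add_mul_I_le (x : ℝ) : ‖(1 : ℂ) + x * Complex.I‖ ≤ Real.exp (x ^ 2 / 2) := by
  have h : ‖(1 : ℂ) + x * Complex.I‖ ^ 2 = 1 + x ^ 2 := by
    rw [← Complex.normSq_eq_norm_sq]
    simp [Complex.normSq_apply]; ring
  refine le_of_sq_le_sq ?_ (Real.exp_pos _).le
  rw [h, ← Real.exp_nat_mul]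
  have := Real.add_one_le_exp (x ^ 2)
  calc 1 + x ^ 2 ≤ Real.exp (x ^ 2) := by linarith
    _ = _ := by congr 1; push_cast; ring

lemma norm_one_add_mul_I_mul_exp_le (x : ℝ) :
    ‖((1 : ℂ) + x * Complex.I) * (Real.exp (-x ^ 2 / 2) : ℝ)‖ ≤ 1 := by
  rw [norm_mul, Complex.norm_real, Real.norm_eq_abs, Real.abs_exp]
  calc _ ≤ Real.exp (x ^ 2 / 2) * Real.exp (-x ^ 2 / 2) := by
        gcongr; exact norm_one_add_mul_I_le x
    _ = 1 := by rw [← Real.exp_add]; simp [neg_div]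

/-- The third order comparison of `exp (ix)` with `(1 + ix) exp (-x² / 2)`. -/
lemma norm_exp_mul_I_sub_le (x : ℝ) :
    ‖Complex.exp (x * Complex.I) -
      ((1 : ℂ) + x * Complex.I) * (Real.exp (-x ^ 2 / 2) : ℝ)‖ ≤ 4 * |x| ^ 3 := by
  rcases le_total |x| 1 with hx | hx
  · have h1 : ‖(x : ℂ) * Complex.I‖ = |x| := by simp
    have e1 := Complex.exp_bound (x := (x : ℂ) * Complex.I) (by rw [h1]; exact hx)
      (n := 3) (by norm_num)
    rw [h1] at e1
    have hx2 : x ^ 2 ≤ 1 := by rw [← sq_abs]; exact pow_le_one₀ (abs_nonneg _) hx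
    have e2 := Real.abs_exp_sub_one_sub_id_le (x := -x ^ 2 / 2) (by
      rw [abs_le]; constructor <;> nlinarith [sq_nonneg x])
    set r := Real.exp (-x ^ 2 / 2) - 1 - (-x ^ 2 / 2) with hr
    have hE : Real.exp (-x ^ 2 / 2) = 1 - x ^ 2 / 2 + r := by rw [hr]; ring
    rw [hE]
    set q := Complex.exp ((x : ℂ) * Complex.I) -
      ∑ m ∈ Finset.range 3, ((x : ℂ) * Complex.I) ^ m / (Nat.factorial m : ℂ) with hq
    -- The terms through order two cancel: `(1 + ix)(1 - x²/2)` differs from the quadratic Taylor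
    -- polynomial of `exp(ix)` only by `-ix³/2`.
    have key : Complex.exp (x * Complex.I) -
        ((1 : ℂ) + x * Complex.I) * ((1 - x ^ 2 / 2 + r : ℝ) : ℂ) =
        q + (x : ℂ) ^ 3 * Complex.I / 2 - ((1 : ℂ) + x * Complex.I) * r := by
      rw [hq]
      simp only [Finset.sum_range_succ, Finset.sum_range_zero, Nat.factorial]
      push_cast
      linear_combination ((x : ℂ) ^ 2 / 2) * Complex.I_sq
    rw [key]
    have n1 : ‖(x : ℂ) ^ 3 * Complex.I / 2‖ = |x| ^ 3 / 2 := by simp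
    have n2 : ‖(1 : ℂ) + x * Complex.I‖ ≤ 2 := by
      refine (norm_add_le _ _).trans ?_
      rw [h1]; simp; linarith
    have n3 : ‖((1 : ℂ) + x * Complex.I) * r‖ ≤ 2 * (|x| ^ 3 / 4) := by
      rw [norm_mul, Complex.norm_real, Real.norm_eq_abs]
      have : |r| ≤ |x| ^ 3 / 4 := by
        refine e2.trans ?_
        have h4 : (-x ^ 2 / 2) ^ 2 = |x| ^ 3 * |x| / 4 := by
          rw [← pow_succ, Even.pow_abs (by decide)]; ring
        rw [h4]
        have := mul_le_mul_of_nonneg_left hx (pow_nonneg (abs_nonneg x) 3)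
        linarith
      gcongr
    have n4 : ‖q‖ ≤ |x| ^ 3 := by
      refine e1.trans ?_
      have : (((3 : ℕ).succ : ℝ) * (((3 : ℕ).factorial : ℝ) * (3 : ℕ))⁻¹) ≤ 1 := by
        norm_num [Nat.factorial]
      exact mul_le_of_le_one_right (by positivity) this
    calc _ ≤ ‖q‖ + ‖(x : ℂ) ^ 3 * Complex.I / 2‖ + ‖((1 : ℂ) + x * Complex.I) * r‖ :=
          (norm_sub_le _ _).trans (by gcongr; exact norm_add_le _ _)
      _ ≤ |x| ^ 3 + |x| ^ 3 / 2 + 2 * (|x| ^ 3 / 4) := by rw [n1]; gcongr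
      _ ≤ _ := by have := pow_nonneg (abs_nonneg x) 3; linarith
  -- For large `x` both terms have norm at most `1`, so the trivial bound `2` suffices.
  · have h1 : 1 ≤ |x| ^ 3 := one_le_pow₀ hx
    have h2 := norm_one_add_mul_I_mul_exp_le x
    have h3 := Complex.norm_exp_ofReal_mul_I x
    have := norm_sub_le (Complex.exp (x * Complex.I))
      (((1 : ℂ) + x * Complex.I) * (Real.exp (-x ^ 2 / 2) : ℝ))
    linarith

/-- Telescoping: the factors are exchanged one at a time, and all the others stay in the unit disc.
-/
lemma norm_prod_sub_prod_le_sum {ι : Type*} (s : Finset ι) (a b : ι → ℂ)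
    (ha : ∀ i, ‖a i‖ ≤ 1) (hb : ∀ i, ‖b i‖ ≤ 1) :
    ‖∏ i ∈ s, a i - ∏ i ∈ s, b i‖ ≤ ∑ i ∈ s, ‖a i - b i‖ := by
  classical
  induction s using Finset.induction_on with
  | empty => simp
  | insert i s hi ih =>
    rw [Finset.prod_insert hi, Finset.prod_insert hi, Finset.sum_insert hi]
    have hbs : ‖∏ i ∈ s, b i‖ ≤ 1 := by
      rw [norm_prod]; exact Finset.prod_le_one (fun _ _ => norm_nonneg _) fun i _ => hb i
    calc _ = ‖a i * (∏ i ∈ s, a i - ∏ i ∈ s, b i) + (a i - b i) * ∏ i ∈ s, b i‖ := by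
          congr 1; ring
      _ ≤ ‖a i‖ * ‖∏ i ∈ s, a i - ∏ i ∈ s, b i‖ + ‖a i - b i‖ * ‖∏ i ∈ s, b i‖ := by
          refine (norm_add_le _ _).trans ?_
          rw [norm_mul, norm_mul]
      _ ≤ 1 * ∑ i ∈ s, ‖a i - b i‖ + ‖a i - b i‖ * 1 := by
          gcongr; exact ha i
      _ = _ := by ring

lemma norm_exp_mul_I_sub_exp_mul_I_le (x y : ℝ) :
    ‖Complex.exp (x * Complex.I) - Complex.exp (y * Complex.I)‖ ≤ |x - y| := by
  have h : Complex.exp (x * Complex.I) - Complex.exp (y * Complex.I) =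
      Complex.exp (y * Complex.I) * (Complex.exp (Complex.I * (x - y : ℝ)) - 1) := by
    rw [mul_sub, ← Complex.exp_add]; push_cast; ring_nf
  rw [h, norm_mul, Complex.norm_exp_ofReal_mul_I, one_mul]
  exact Real.norm_exp_I_mul_ofReal_sub_one_le

lemma abs_exp_neg_sub_exp_neg_le {x y : ℝ} (hx : 0 ≤ x) (hy : 0 ≤ y) :
    |Real.exp (-x) - Real.exp (-y)| ≤ |x - y| := by
  wlog h : x ≤ y generalizing x y
  · rw [abs_sub_comm, abs_sub_comm x]; exact this hy hx (le_of_not_ge h)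
  rw [abs_of_nonneg (sub_nonneg.2 (Real.exp_le_exp.2 (neg_le_neg h))), abs_sub_comm,
    abs_of_nonneg (sub_nonneg.2 h)]
  have h1 := Real.add_one_le_exp (x - y)
  have h2 : Real.exp (-y) = Real.exp (-x) * Real.exp (x - y) := by
    rw [← Real.exp_add]; ring_nf
  have h3 : Real.exp (-x) ≤ 1 := Real.exp_le_one_iff.2 (by linarith)
  rw [h2]
  nlinarith [Real.exp_pos (-x)]

/-- A real truncated at level one: `x · I(|x| ≤ 1)`. -/
def clip (x : ℝ) : ℝ := {x : ℝ | |x| ≤ 1}.indicator id x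

lemma clip_of_le {x : ℝ} (h : |x| ≤ 1) : clip x = x := by simp [clip, h]

lemma clip_of_gt {x : ℝ} (h : 1 < |x|) : clip x = 0 := by simp [clip, h]

lemma abs_clip_le (x : ℝ) : |clip x| ≤ 1 := by
  rcases le_or_gt |x| 1 with h | h
  · rwa [clip_of_le h]
  · simp [clip_of_gt h]

lemma measurable_clip : Measurable clip :=
  measurable_id.indicator (measurableSet_le measurable_norm measurable_const)

/-- Partial sums of the squares of the clipped sequence. -/
def clipQV (x : ℕ → ℝ) (n : ℕ) : ℝ := ∑ k ∈ Finset.range n, clip (x k) ^ 2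

/-- The clipped sequence, stopped when the sum of squares exceeds two. -/
def stopped (x : ℕ → ℝ) (k : ℕ) : ℝ := {y : ℝ | y ≤ 2}.indicator (fun _ => clip (x k)) (clipQV x k)

/-- The product `∏ (1 + i t z_k)` over the stopped sequence. -/
def stoppedProd (t : ℝ) (x : ℕ → ℝ) (n : ℕ) : ℂ :=
  ∏ k ∈ Finset.range n, ((1 : ℂ) + (t * stopped x k : ℝ) * Complex.I)

lemma clipQV_mono (x : ℕ → ℝ) : Monotone (clipQV x) :=
  monotone_nat_of_le_succ fun n => by
    rw [clipQV, clipQV, Finset.sum_range_succ]; linarith [sq_nonneg (clip (x n))]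

lemma stopped_of_le {x : ℕ → ℝ} {k : ℕ} (h : clipQV x k ≤ 2) : stopped x k = clip (x k) := by
  simp [stopped, h]

lemma stopped_of_gt {x : ℕ → ℝ} {k : ℕ} (h : 2 < clipQV x k) : stopped x k = 0 := by
  simp [stopped, h]

lemma abs_stopped_le (x : ℕ → ℝ) (k : ℕ) : |stopped x k| ≤ |clip (x k)| := by
  rcases le_or_gt (clipQV x k) 2 with h | h
  · rw [stopped_of_le h]
  · simp [stopped_of_gt h]

/-- The running sum is at most `2` when the last nonzero term is added, and that term contributes at
most `1`. -/
lemma sum_stopped_sq_le (x : ℕ → ℝ) (n : ℕ) :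
    ∑ k ∈ Finset.range n, stopped x k ^ 2 ≤ 3 := by
  induction n with
  | zero => simp
  | succ n ih =>
    rw [Finset.sum_range_succ]
    rcases le_or_gt (clipQV x n) 2 with h | h
    · have h1 : ∑ k ∈ Finset.range n, stopped x k ^ 2 ≤ clipQV x n :=
        Finset.sum_le_sum fun k _ => sq_le_sq.2 (abs_stopped_le x k)
      have h2 : stopped x n ^ 2 ≤ 1 := by
        rw [sq_le_one_iff_abs_le_one]; exact (abs_stopped_le x n).trans (abs_clip_le _)
      linarith
    · rw [stopped_of_gt h]; simpa using ih

lemma norm_stoppedProd_le (t : ℝ) (x : ℕ → ℝ) (n : ℕ) :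
    ‖stoppedProd t x n‖ ≤ Real.exp (2 * t ^ 2) := by
  rw [stoppedProd, norm_prod]
  calc _ ≤ ∏ k ∈ Finset.range n, Real.exp ((t * stopped x k) ^ 2 / 2) :=
        Finset.prod_le_prod (fun _ _ => norm_nonneg _) fun k _ => norm_one_add_mul_I_le _
    _ = Real.exp (t ^ 2 / 2 * ∑ k ∈ Finset.range n, stopped x k ^ 2) := by
        rw [← Real.exp_sum, Finset.mul_sum]; congr 1
        exact Finset.sum_congr rfl fun k _ => by ring
    _ ≤ _ := by
        rw [Real.exp_le_exp]
        -- The exponent is at most `3t²/2`; the constant `2` is a rounding up.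
        nlinarith [sum_stopped_sq_le x n, sq_nonneg t]

lemma norm_exp_sum_stopped_sub_le (t : ℝ) (x : ℕ → ℝ) (n : ℕ) :
    ‖Complex.exp ((t * ∑ k ∈ Finset.range n, stopped x k : ℝ) * Complex.I) -
      stoppedProd t x n *
        (Real.exp (-(t ^ 2 / 2 * ∑ k ∈ Finset.range n, stopped x k ^ 2)) : ℝ)‖ ≤
      4 * |t| ^ 3 * ∑ k ∈ Finset.range n, |clip (x k)| ^ 3 := by
  have h1 : Complex.exp ((t * ∑ k ∈ Finset.range n, stopped x k : ℝ) * Complex.I) =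
      ∏ k ∈ Finset.range n, Complex.exp ((t * stopped x k : ℝ) * Complex.I) := by
    rw [← Complex.exp_sum, Finset.mul_sum]; push_cast; rw [Finset.sum_mul]
  have h2 : stoppedProd t x n *
        (Real.exp (-(t ^ 2 / 2 * ∑ k ∈ Finset.range n, stopped x k ^ 2)) : ℝ) =
      ∏ k ∈ Finset.range n, (((1 : ℂ) + (t * stopped x k : ℝ) * Complex.I) *
        (Real.exp (-(t * stopped x k) ^ 2 / 2) : ℝ)) := by
    rw [Finset.prod_mul_distrib, stoppedProd, ← Complex.ofReal_prod, ← Real.exp_sum,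
      Finset.mul_sum, ← Finset.sum_neg_distrib]
    congr 5 with k
    ring
  rw [h1, h2, Finset.mul_sum]
  refine (norm_prod_sub_prod_le_sum _ _ _ (fun k => (Complex.norm_exp_ofReal_mul_I _).le)
    fun k => norm_one_add_mul_I_mul_exp_le _).trans (Finset.sum_le_sum fun k _ => ?_)
  refine (norm_exp_mul_I_sub_le _).trans ?_
  rw [abs_mul, mul_pow, mul_assoc]
  have := pow_le_pow_left₀ (abs_nonneg _) (abs_stopped_le x k) 3
  gcongr

/-- If `clipQV x n ≤ 2`, stopping has not acted. Otherwise the right side exceeds `2`, while the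
stopped sum lies in `[0, 3]`. -/
lemma abs_sum_stopped_sq_sub_one_le (x : ℕ → ℝ) (n : ℕ) :
    |∑ k ∈ Finset.range n, stopped x k ^ 2 - 1| ≤ 2 * |clipQV x n - 1| := by
  rcases le_or_gt (clipQV x n) 2 with h | h
  · have : ∑ k ∈ Finset.range n, stopped x k ^ 2 = clipQV x n :=
      Finset.sum_congr rfl fun k hk => by
        rw [stopped_of_le ((clipQV_mono x (Finset.mem_range.1 hk).le).trans h)]
    rw [this]; linarith [abs_nonneg (clipQV x n - 1)]
  · have h0 : 0 ≤ ∑ k ∈ Finset.range n, stopped x k ^ 2 :=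
      Finset.sum_nonneg fun _ _ => sq_nonneg _
    have h3 := sum_stopped_sq_le x n
    have h4 : |∑ k ∈ Finset.range n, stopped x k ^ 2 - 1| ≤ 2 := by
      rw [abs_le]; constructor <;> linarith
    have := le_abs_self (clipQV x n - 1)
    linarith

/-- Once stopping has acted, two unimodular numbers differ by at most `2 ≤ 2 |clipQV x n - 1|`. The
stopping event thus needs no separate probability estimate. -/
lemma norm_exp_sum_sub_exp_sum_stopped_le (t : ℝ) (x : ℕ → ℝ) (n : ℕ) :
    ‖Complex.exp ((t * ∑ k ∈ Finset.range n, x k : ℝ) * Complex.I) -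
      Complex.exp ((t * ∑ k ∈ Finset.range n, stopped x k : ℝ) * Complex.I)‖ ≤
      |t| * ∑ k ∈ Finset.range n, |x k - clip (x k)| + 2 * |clipQV x n - 1| := by
  rcases le_or_gt (clipQV x n) 2 with h | h
  · have : ∑ k ∈ Finset.range n, stopped x k = ∑ k ∈ Finset.range n, clip (x k) :=
      Finset.sum_congr rfl fun k hk => by
        rw [stopped_of_le ((clipQV_mono x (Finset.mem_range.1 hk).le).trans h)]
    rw [this]
    refine (norm_exp_mul_I_sub_exp_mul_I_le _ _).trans ?_
    rw [← mul_sub, abs_mul, ← Finset.sum_sub_distrib]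
    have h1 := Finset.abs_sum_le_sum_abs (fun k => x k - clip (x k)) (Finset.range n)
    have := mul_le_mul_of_nonneg_left h1 (abs_nonneg t)
    linarith [abs_nonneg (clipQV x n - 1)]
  · have h1 := norm_sub_le (Complex.exp ((t * ∑ k ∈ Finset.range n, x k : ℝ) * Complex.I))
      (Complex.exp ((t * ∑ k ∈ Finset.range n, stopped x k : ℝ) * Complex.I))
    rw [Complex.norm_exp_ofReal_mul_I, Complex.norm_exp_ofReal_mul_I] at h1
    have h2 : 0 ≤ |t| * ∑ k ∈ Finset.range n, |x k - clip (x k)| := by positivity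
    have := le_abs_self (clipQV x n - 1)
    linarith

/-- Pointwise comparison of `exp (i t ∑ x_k)` with `exp (-t² / 2) ∏ (1 + i t z_k)`. -/
lemma norm_exp_sum_sub_stoppedProd_le (t : ℝ) (x : ℕ → ℝ) (n : ℕ) :
    ‖Complex.exp ((t * ∑ k ∈ Finset.range n, x k : ℝ) * Complex.I) -
      stoppedProd t x n * (Real.exp (-(t ^ 2 / 2)) : ℝ)‖ ≤
      |t| * ∑ k ∈ Finset.range n, |x k - clip (x k)| +
      4 * |t| ^ 3 * ∑ k ∈ Finset.range n, |clip (x k)| ^ 3 +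
      (2 + Real.exp (2 * t ^ 2) * t ^ 2) * |clipQV x n - 1| := by
  have h1 := norm_exp_sum_sub_exp_sum_stopped_le t x n
  have h2 := norm_exp_sum_stopped_sub_le t x n
  set W := ∑ k ∈ Finset.range n, stopped x k ^ 2 with hW
  have hW0 : 0 ≤ W := Finset.sum_nonneg fun _ _ => sq_nonneg _
  -- Last of three replacements: the random sum of squares `W` in the exponent gives way to its
  -- target value `1`.
  have h3 : ‖stoppedProd t x n * (Real.exp (-(t ^ 2 / 2 * W)) : ℝ) -
      stoppedProd t x n * (Real.exp (-(t ^ 2 / 2)) : ℝ)‖ ≤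
      Real.exp (2 * t ^ 2) * t ^ 2 * |clipQV x n - 1| := by
    rw [← mul_sub, norm_mul, ← Complex.ofReal_sub, Complex.norm_real, Real.norm_eq_abs, mul_assoc]
    refine mul_le_mul (norm_stoppedProd_le t x n) ?_ (abs_nonneg _) (Real.exp_pos _).le
    refine (abs_exp_neg_sub_exp_neg_le (by positivity) (by positivity)).trans ?_
    have : t ^ 2 / 2 * W - t ^ 2 / 2 = t ^ 2 / 2 * (W - 1) := by ring
    rw [this, abs_mul, abs_of_nonneg (by positivity : 0 ≤ t ^ 2 / 2)]
    nlinarith [abs_sum_stopped_sq_sub_one_le x n, sq_nonneg t]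
  have := norm_sub_le_norm_sub_add_norm_sub
    (Complex.exp ((t * ∑ k ∈ Finset.range n, x k : ℝ) * Complex.I))
    (Complex.exp ((t * ∑ k ∈ Finset.range n, stopped x k : ℝ) * Complex.I))
    (stoppedProd t x n * (Real.exp (-(t ^ 2 / 2)) : ℝ))
  have := norm_sub_le_norm_sub_add_norm_sub
    (Complex.exp ((t * ∑ k ∈ Finset.range n, stopped x k : ℝ) * Complex.I))
    (stoppedProd t x n * (Real.exp (-(t ^ 2 / 2 * W)) : ℝ))
    (stoppedProd t x n * (Real.exp (-(t ^ 2 / 2)) : ℝ))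
  linarith

end CharFunBound

/-! ### A quantitative martingale central limit theorem. -/

section MartingaleCharFun

variable {Ω : Type*}

lemma measurable_clipQV {m : MeasurableSpace Ω} {X : ℕ → Ω → ℝ} {n : ℕ}
    (hX : ∀ k < n, Measurable[m] (X k)) : Measurable[m] fun ω => clipQV (X · ω) n :=
  Finset.measurable_fun_sum _ fun k hk =>
    (measurable_clip.comp (hX k (Finset.mem_range.1 hk))).pow_const 2

lemma measurable_stopped {m : MeasurableSpace Ω} {X : ℕ → Ω → ℝ} {n : ℕ}
    (hX : ∀ k ≤ n, Measurable[m] (X k)) : Measurable[m] fun ω => stopped (X · ω) n := by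
  have h := measurable_clipQV (n := n) fun k hk => hX k hk.le
  exact (measurable_clip.comp (hX n le_rfl)).indicator (h measurableSet_Iic)

lemma measurable_stoppedProd {m : MeasurableSpace Ω} {X : ℕ → Ω → ℝ} {n : ℕ}
    (hX : ∀ k < n, Measurable[m] (X k)) (t : ℝ) :
    Measurable[m] fun ω => stoppedProd t (X · ω) n := by
  refine Finset.measurable_fun_prod _ fun k hk => ?_
  have h : Measurable[m] fun ω => stopped (X · ω) k :=
    measurable_stopped fun j hj => hX j (hj.trans_lt (Finset.mem_range.1 hk))
  exact (((Complex.measurable_ofReal.comp (h.const_mul t))).mul_const _).const_add _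

variable {mΩ : MeasurableSpace Ω} {μ : Measure Ω} [IsProbabilityMeasure μ]

/-- The known factor is pulled out of the conditional expectation. As it is complex and `X` is real,
the product is treated as the bilinear map of scalar multiplication. -/
lemma integral_mul_eq_zero_of_condExp_eq_zero {m : MeasurableSpace Ω} (hm : m ≤ mΩ)
    {T : Ω → ℂ} {X : Ω → ℝ} {C : ℝ} (hT : Measurable[m] T) (hC : ∀ ω, ‖T ω‖ ≤ C)
    (hX : Integrable X μ) (hce : μ[X | m] =ᵐ[μ] 0) : ∫ ω, T ω * (X ω : ℂ) ∂μ = 0 := by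
  have hint : Integrable (fun ω => T ω * (X ω : ℂ)) μ :=
    hX.ofReal.bdd_mul (hT.mono hm le_rfl).aestronglyMeasurable (ae_of_all _ hC)
  have h := condExp_bilin_of_stronglyMeasurable_left (μ := μ) (m := m)
    ((ContinuousLinearMap.lsmul ℝ ℝ : ℝ →L[ℝ] ℂ →L[ℝ] ℂ).flip) hT.stronglyMeasurable
    (g := X) (by simpa [mul_comm] using hint) hX
  rw [← integral_condExp hm]
  rw [integral_eq_zero_of_ae]
  have h' : μ[fun ω => T ω * (X ω : ℂ) | m] =ᵐ[μ]
      fun ω => ((ContinuousLinearMap.lsmul ℝ ℝ : ℝ →L[ℝ] ℂ →L[ℝ] ℂ).flip) (T ω) (μ[X | m] ω) := by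
    refine EventuallyEq.trans (condExp_congr_ae (ae_of_all _ fun ω => ?_)) h
    simp [mul_comm]
  filter_upwards [h', hce] with ω h1 h2
  rw [h1, h2]; simp

variable (𝒢 : Filtration ℕ mΩ) {X : ℕ → Ω → ℝ}

lemma integrable_clip_comp {Y : Ω → ℝ} (hY : Measurable Y) :
    Integrable (fun ω => clip (Y ω)) μ :=
  Integrable.of_bound (measurable_clip.comp hY).aestronglyMeasurable 1
    (ae_of_all _ fun _ => abs_clip_le _)

lemma integrable_stoppedProd (hXm : ∀ k, Measurable (X k)) (t : ℝ) (n : ℕ) :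
    Integrable (fun ω => stoppedProd t (X · ω) n) μ :=
  Integrable.of_bound (measurable_stoppedProd (fun k _ => hXm k) t).aestronglyMeasurable
    (Real.exp (2 * t ^ 2)) (ae_of_all _ fun _ => norm_stoppedProd_le t _ n)

/-- With unclipped factors the product would be a martingale of mean `1`. Clipping spoils the
centering, and each step costs the `L¹` clipping error times the uniform bound on the product. -/
lemma norm_integral_stoppedProd_sub_one_le (hXm : ∀ k, Measurable[𝒢 (k + 1)] (X k))
    (hXi : ∀ k, Integrable (X k) μ) (hce : ∀ k, μ[X k | 𝒢 k] =ᵐ[μ] 0) (t : ℝ) (n : ℕ) :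
    ‖∫ ω, stoppedProd t (X · ω) n ∂μ - 1‖ ≤
      |t| * Real.exp (2 * t ^ 2) * ∑ k ∈ Finset.range n, ∫ ω, |X k ω - clip (X k ω)| ∂μ := by
  have hXm' k : Measurable (X k) := (hXm k).mono (𝒢.le _) le_rfl
  induction n with
  | zero => simp [stoppedProd]
  | succ n ih =>
    -- The stopping rule looks only at indices below `n`, so `P` is `𝒢 n`-measurable and is
    -- orthogonal to `X n`.
    set P : Ω → ℂ := fun ω => stoppedProd t (X · ω) n *
      ({y : ℝ | y ≤ 2}.indicator (fun _ => (1 : ℂ)) (clipQV (X · ω) n)) with hP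
    have hPm : Measurable[𝒢 n] P := by
      have hm : ∀ k < n, Measurable[𝒢 n] (X k) := fun k hk =>
        (hXm k).mono (𝒢.mono hk) le_rfl
      have h2 : Measurable fun y : ℝ => {y : ℝ | y ≤ 2}.indicator (fun _ => (1 : ℂ)) y :=
        measurable_const.indicator measurableSet_Iic
      exact (measurable_stoppedProd hm t).mul (h2.comp (measurable_clipQV hm))
    have hPb ω : ‖P ω‖ ≤ Real.exp (2 * t ^ 2) := by
      rw [hP]; dsimp only
      rw [norm_mul, ← mul_one (Real.exp _)]
      refine mul_le_mul (norm_stoppedProd_le _ _ _) ?_ (norm_nonneg _) (Real.exp_pos _).le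
      refine (norm_indicator_le_norm_self _ _).trans (by simp)
    have hstep ω : stoppedProd t (X · ω) (n + 1) =
        stoppedProd t (X · ω) n + (t * Complex.I) * (P ω * (X n ω : ℂ)) -
          (t * Complex.I) * (P ω * ((X n ω - clip (X n ω) : ℝ) : ℂ)) := by
      have : ((stopped (X · ω) n : ℝ) : ℂ) =
          ({y : ℝ | y ≤ 2}.indicator (fun _ => (1 : ℂ)) (clipQV (X · ω) n)) * clip (X n ω) := by
        rcases le_or_gt (clipQV (X · ω) n) 2 with h | h
        · simp [stopped_of_le h, h]
        · simp [stopped_of_gt h, h]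
      simp only [stoppedProd, Finset.prod_range_succ, hP] at *
      push_cast at *
      rw [this]; ring
    have hPm' := (hPm.mono (𝒢.le n) le_rfl).aestronglyMeasurable (μ := μ)
    have hi1 : Integrable (fun ω => P ω * (X n ω : ℂ)) μ :=
      (hXi n).ofReal.bdd_mul hPm' (ae_of_all _ hPb)
    have hd : Integrable (fun ω => X n ω - clip (X n ω)) μ :=
      (hXi n).sub (integrable_clip_comp (hXm' n))
    have hi2 : Integrable (fun ω => P ω * ((X n ω - clip (X n ω) : ℝ) : ℂ)) μ :=
      hd.ofReal.bdd_mul hPm' (ae_of_all _ hPb)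
    have h0 := integral_mul_eq_zero_of_condExp_eq_zero (𝒢.le n) hPm hPb (hXi n) (hce n)
    have heq : ∫ ω, stoppedProd t (X · ω) (n + 1) ∂μ - 1 =
        (∫ ω, stoppedProd t (X · ω) n ∂μ - 1) -
          (t * Complex.I) * ∫ ω, P ω * ((X n ω - clip (X n ω) : ℝ) : ℂ) ∂μ := by
      have iadd : Integrable (fun ω => stoppedProd t (X · ω) n +
          (t * Complex.I) * (P ω * (X n ω : ℂ))) μ :=
        (integrable_stoppedProd hXm' t n).add (hi1.const_mul _)
      simp_rw [hstep]
      rw [integral_sub iadd (hi2.const_mul _), integral_add (integrable_stoppedProd hXm' t n) (hi1.const_mul _),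
        integral_const_mul, integral_const_mul, h0]
      ring
    have hb : ‖∫ ω, P ω * ((X n ω - clip (X n ω) : ℝ) : ℂ) ∂μ‖ ≤
        Real.exp (2 * t ^ 2) * ∫ ω, |X n ω - clip (X n ω)| ∂μ := by
      rw [← integral_const_mul]
      refine norm_integral_le_of_norm_le (hd.abs.const_mul _) (ae_of_all _ fun ω => ?_)
      rw [norm_mul, Complex.norm_real, Real.norm_eq_abs]
      exact mul_le_mul_of_nonneg_right (hPb ω) (abs_nonneg _)
    rw [heq, Finset.sum_range_succ]
    refine (norm_sub_le _ _).trans ?_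
    rw [norm_mul (_ * _), norm_mul (t : ℂ), Complex.norm_I, Complex.norm_real, Real.norm_eq_abs,
      mul_one, mul_add]
    refine add_le_add ih ?_
    rw [mul_assoc]
    exact mul_le_mul_of_nonneg_left hb (abs_nonneg _)

/-- A quantitative martingale central limit theorem: the characteristic function of a sum of
martingale differences is close to that of the standard normal law. -/
theorem norm_integral_exp_sum_sub_le (hXm : ∀ k, Measurable[𝒢 (k + 1)] (X k))
    (hXi : ∀ k, Integrable (X k) μ) (hce : ∀ k, μ[X k | 𝒢 k] =ᵐ[μ] 0) (t : ℝ) (n : ℕ) :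
    ‖∫ ω, Complex.exp ((t * ∑ k ∈ Finset.range n, X k ω : ℝ) * Complex.I) ∂μ -
      (Real.exp (-(t ^ 2 / 2)) : ℝ)‖ ≤
      (|t| + |t| * Real.exp (2 * t ^ 2)) *
        ∑ k ∈ Finset.range n, ∫ ω, |X k ω - clip (X k ω)| ∂μ +
      4 * |t| ^ 3 * ∑ k ∈ Finset.range n, ∫ ω, |clip (X k ω)| ^ 3 ∂μ +
      (2 + Real.exp (2 * t ^ 2) * t ^ 2) * ∫ ω, |clipQV (X · ω) n - 1| ∂μ := by
  have hXm' k : Measurable (X k) := (hXm k).mono (𝒢.le _) le_rfl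
  have i1 k : Integrable (fun ω => |X k ω - clip (X k ω)|) μ :=
    ((hXi k).sub (integrable_clip_comp (hXm' k))).abs
  have i2 k : Integrable (fun ω => |clip (X k ω)| ^ 3) μ := by
    refine Integrable.of_bound
      ((measurable_clip.comp (hXm' k)).abs.pow_const 3).aestronglyMeasurable 1
      (ae_of_all _ fun ω => ?_)
    rw [Real.norm_eq_abs, abs_pow, abs_abs]
    exact pow_le_one₀ (abs_nonneg _) (abs_clip_le _)
  have i3 : Integrable (fun ω => |clipQV (X · ω) n - 1|) μ := by
    refine Integrable.abs (Integrable.sub (integrable_finsetSum _ fun k _ => ?_)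
      (integrable_const _))
    refine Integrable.of_bound
      ((measurable_clip.comp (hXm' k)).pow_const 2).aestronglyMeasurable 1
      (ae_of_all _ fun ω => ?_)
    rw [Real.norm_eq_abs, abs_pow]
    exact pow_le_one₀ (abs_nonneg _) (abs_clip_le _)
  have hT := norm_integral_stoppedProd_sub_one_le 𝒢 hXm hXi hce t n
  have iT := integrable_stoppedProd (μ := μ) hXm' t n
  have iE : Integrable
      (fun ω => Complex.exp ((t * ∑ k ∈ Finset.range n, X k ω : ℝ) * Complex.I)) μ := by
    refine Integrable.of_bound ?_ 1 (ae_of_all _ fun ω => (Complex.norm_exp_ofReal_mul_I _).le)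
    have : Measurable fun ω => t * ∑ k ∈ Finset.range n, X k ω :=
      (Finset.measurable_fun_sum _ fun k _ => hXm' k).const_mul t
    exact (Complex.measurable_exp.comp
      ((Complex.measurable_ofReal.comp this).mul_const _)).aestronglyMeasurable
  have key : ‖∫ ω, Complex.exp ((t * ∑ k ∈ Finset.range n, X k ω : ℝ) * Complex.I) ∂μ -
      (∫ ω, stoppedProd t (X · ω) n ∂μ) * (Real.exp (-(t ^ 2 / 2)) : ℝ)‖ ≤
      |t| * ∑ k ∈ Finset.range n, ∫ ω, |X k ω - clip (X k ω)| ∂μ +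
      4 * |t| ^ 3 * ∑ k ∈ Finset.range n, ∫ ω, |clip (X k ω)| ^ 3 ∂μ +
      (2 + Real.exp (2 * t ^ 2) * t ^ 2) * ∫ ω, |clipQV (X · ω) n - 1| ∂μ := by
    have j1 := (integrable_finsetSum (Finset.range n) fun k _ => i1 k).const_mul |t|
    have j2 := (integrable_finsetSum (Finset.range n) fun k _ => i2 k).const_mul (4 * |t| ^ 3)
    have j3 := i3.const_mul (2 + Real.exp (2 * t ^ 2) * t ^ 2)
    rw [← integral_mul_const, ← integral_sub iE (iT.mul_const _)]
    refine (norm_integral_le_of_norm_le ((j1.add j2).add j3)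
      (ae_of_all _ fun ω => norm_exp_sum_sub_stoppedProd_le t (X · ω) n)).trans_eq ?_
    rw [integral_add' (j1.add j2) j3, integral_add' j1 j2, integral_const_mul, integral_const_mul,
      integral_const_mul, integral_finsetSum _ fun k _ => i1 k,
      integral_finsetSum _ fun k _ => i2 k]
  -- Replacing the mean of the product by `1` costs no more than `hT`, as the Gaussian factor is at
  -- most `1`.
  have h1 : ‖(∫ ω, stoppedProd t (X · ω) n ∂μ) * (Real.exp (-(t ^ 2 / 2)) : ℝ) -
      (Real.exp (-(t ^ 2 / 2)) : ℝ)‖ ≤ ‖∫ ω, stoppedProd t (X · ω) n ∂μ - 1‖ := by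
    rw [← sub_one_mul, norm_mul, Complex.norm_real, Real.norm_eq_abs, Real.abs_exp]
    refine mul_le_of_le_one_right (norm_nonneg _) (Real.exp_le_one_iff.2 ?_)
    linarith [sq_nonneg t]
  have := norm_sub_le_norm_sub_add_norm_sub
    (∫ ω, Complex.exp ((t * ∑ k ∈ Finset.range n, X k ω : ℝ) * Complex.I) ∂μ)
    ((∫ ω, stoppedProd t (X · ω) n ∂μ) * (Real.exp (-(t ^ 2 / 2)) : ℝ))
    ((Real.exp (-(t ^ 2 / 2)) : ℝ) : ℂ)
  linarith

end MartingaleCharFun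

/-! ### Truncated moments under slow variation. -/

section SlowVariation

variable {Ω : Type*}

lemma truncSq_of_le {X : Ω → ℝ} {a : ℝ} {ω : Ω} (h : |X ω| ≤ a) : truncSq X a ω = X ω ^ 2 := by
  simp [truncSq, h]

lemma truncSq_of_gt {X : Ω → ℝ} {a : ℝ} {ω : Ω} (h : a < |X ω|) : truncSq X a ω = 0 := by
  simp [truncSq, h]

lemma truncSq_nonneg (X : Ω → ℝ) (a : ℝ) (ω : Ω) : 0 ≤ truncSq X a ω :=
  Set.indicator_nonneg (fun _ _ => sq_nonneg _) _

lemma truncSq_mono (X : Ω → ℝ) (ω : Ω) : Monotone fun a => truncSq X a ω := fun a b hab => by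
  rcases le_or_gt |X ω| a with h | h
  · simp only [truncSq_of_le h, truncSq_of_le (h.trans hab), le_refl]
  · simp only [truncSq_of_gt h]; exact truncSq_nonneg X b ω

lemma truncSq_le_sq (X : Ω → ℝ) (a : ℝ) (ω : Ω) : truncSq X a ω ≤ a ^ 2 := by
  rcases le_or_gt |X ω| a with h | h
  · rw [truncSq_of_le h, ← sq_abs]; exact pow_le_pow_left₀ (abs_nonneg _) h 2
  · rw [truncSq_of_gt h]; exact sq_nonneg a

/-- Translates clipping at `1` into truncation at `|c|⁻¹`. At `c = 0` the inverse is `0` by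
convention, but the factor `c ^ 2` kills the term. -/
lemma clip_mul_sq (X : Ω → ℝ) (c : ℝ) (ω : Ω) :
    clip (c * X ω) ^ 2 = c ^ 2 * truncSq X |c|⁻¹ ω := by
  rcases eq_or_ne c 0 with rfl | hc
  · simp [clip]
  have hc' : 0 < |c| := abs_pos.2 hc
  rcases le_or_gt |X ω| |c|⁻¹ with h | h
  · have : |c * X ω| ≤ 1 := by
      rwa [abs_mul, ← le_inv_mul_iff₀ hc', mul_one]
    rw [truncSq_of_le h, clip_of_le this]; ring
  · have : 1 < |c * X ω| := by
      rw [abs_mul]; rwa [inv_lt_iff_one_lt_mul₀' hc'] at h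
    rw [truncSq_of_gt h, clip_of_gt this]; ring

variable {mΩ : MeasurableSpace Ω} {μ : Measure Ω} {X : Ω → ℝ}

lemma measurable_truncSq (hX : Measurable X) (a : ℝ) : Measurable (truncSq X a) :=
  (hX.pow_const 2).indicator (measurableSet_le hX.abs measurable_const)

lemma memLp_truncSq [IsFiniteMeasure μ] (hX : Measurable X) (a : ℝ) (p : ENNReal) : MemLp (truncSq X a) p μ :=
  MemLp.of_bound (measurable_truncSq hX a).aestronglyMeasurable (a ^ 2) (ae_of_all _ fun ω => by
    rw [Real.norm_eq_abs, abs_of_nonneg (truncSq_nonneg X a ω)]; exact truncSq_le_sq X a ω)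

lemma integrable_truncSq [IsFiniteMeasure μ] (hX : Measurable X) (a : ℝ) : Integrable (truncSq X a) μ :=
  memLp_one_iff_integrable.1 (memLp_truncSq hX a 1)

lemma truncMoment_nonneg (x : ℝ) : 0 ≤ truncMoment μ X x :=
  integral_nonneg (truncSq_nonneg X x)

lemma truncMoment_mono [IsFiniteMeasure μ] (hX : Measurable X) : Monotone (truncMoment μ X) := fun _ _ hab =>
  integral_mono (integrable_truncSq hX _) (integrable_truncSq hX _)
    fun ω => truncSq_mono X ω hab

/-- Monotone convergence: truncated moments bounded by `1` would bound the second moment. This makes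
the infimum in `truncLevel` one over a nonempty set. -/
lemma exists_one_lt_truncMoment [IsFiniteMeasure μ] (hX : Measurable X)
    (h_inf : ∫⁻ ω, ENNReal.ofReal (X ω ^ 2) ∂μ = ⊤) : ∃ x, 0 ≤ x ∧ 1 < truncMoment μ X x := by
  by_contra! h
  have h1 : Tendsto (fun n : ℕ => ∫⁻ ω, ENNReal.ofReal (truncSq X n ω) ∂μ) atTop
      (𝓝 (∫⁻ ω, ENNReal.ofReal (X ω ^ 2) ∂μ)) := by
    refine lintegral_tendsto_of_tendsto_of_monotone
      (fun n => (measurable_truncSq hX n).ennreal_ofReal.aemeasurable)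
      (ae_of_all _ fun ω i j hij => ENNReal.ofReal_le_ofReal
        (truncSq_mono X ω (by exact_mod_cast hij))) (ae_of_all _ fun ω => ?_)
    refine tendsto_const_nhds.congr' ?_
    filter_upwards [tendsto_natCast_atTop_atTop.eventually_ge_atTop |X ω|] with n hn
    rw [truncSq_of_le hn]
  have h2 : ∫⁻ ω, ENNReal.ofReal (X ω ^ 2) ∂μ ≤ 1 := by
    refine le_of_tendsto' h1 fun n => ?_
    rw [← ofReal_integral_eq_lintegral_ofReal (integrable_truncSq hX _)
      (ae_of_all _ (truncSq_nonneg X n))]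
    exact ENNReal.ofReal_le_one.2 (h n n.cast_nonneg)
  rw [h_inf] at h2
  simp at h2

/-- The shift by `1` in `H` leaves room for a point of the level set below the truncation point,
whether or not the infimum is attained. -/
lemma one_le_H [IsFiniteMeasure μ] (hX : Measurable X) (h_inf : ∫⁻ ω, ENNReal.ofReal (X ω ^ 2) ∂μ = ⊤) (x : ℝ) :
    1 ≤ H μ X x := by
  obtain ⟨y, hy, hlt⟩ := exists_lt_of_csInf_lt (exists_one_lt_truncMoment hX h_inf)
    (lt_add_one (truncLevel μ X))
  exact hy.2.le.trans (truncMoment_mono hX (hlt.le.trans (le_max_right _ _)))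

lemma H_eq_truncMoment {x : ℝ} (hx : truncLevel μ X + 1 ≤ x) : H μ X x = truncMoment μ X x := by
  rw [H, max_eq_left hx]

/-- The truncated first moment of the tail, `E (|X| I(|X| > x))`. -/
def tailMoment (μ : Measure Ω) (X : Ω → ℝ) (x : ℝ) : ℝ :=
  ∫ ω, {ω | x < |X ω|}.indicator (fun ω => |X ω|) ω ∂μ

lemma integrable_tail (hX : Measurable X) (hi : Integrable X μ) (x : ℝ) :
    Integrable ({ω | x < |X ω|}.indicator fun ω => |X ω|) μ :=
  hi.abs.indicator (measurableSet_lt measurable_const hX.abs)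

lemma tendsto_tailMoment (hX : Measurable X) (hi : Integrable X μ) :
    Tendsto (tailMoment μ X) atTop (𝓝 0) := by
  rw [← integral_zero Ω ℝ (μ := μ)]
  refine tendsto_integral_filter_of_dominated_convergence (fun ω => |X ω|)
    (Eventually.of_forall fun x => (integrable_tail hX hi x).aestronglyMeasurable)
    (Eventually.of_forall fun x => ae_of_all _ fun ω => ?_) hi.abs (ae_of_all _ fun ω => ?_)
  · exact (norm_indicator_le_norm_self _ _).trans (by simp)
  · refine tendsto_const_nhds.congr' ?_
    filter_upwards [eventually_ge_atTop |X ω|] with x hx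
    rw [Set.indicator_of_notMem]
    simpa using hx

/-- On the shell `x < |X| ≤ 2x` one has `|X| ≤ X² / x`. This is one step of a dyadic decomposition
of the tail. -/
lemma tailMoment_le [IsFiniteMeasure μ] (hX : Measurable X) (hi : Integrable X μ) {x : ℝ} (hx : 0 < x) :
    tailMoment μ X x ≤
      (truncMoment μ X (2 * x) - truncMoment μ X x) / x + tailMoment μ X (2 * x) := by
  have i1 : Integrable (fun ω => (truncSq X (2 * x) ω - truncSq X x ω) / x) μ :=
    ((integrable_truncSq hX _).sub (integrable_truncSq hX _)).div_const x
  have i2 := integrable_tail hX hi (2 * x)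
  rw [truncMoment, truncMoment, tailMoment, tailMoment,
    ← integral_sub (integrable_truncSq hX _) (integrable_truncSq hX _), ← integral_div,
    ← integral_add i1 i2]
  refine integral_mono (integrable_tail hX hi _) (i1.add i2) fun ω => ?_
  beta_reduce
  rcases le_or_gt |X ω| x with h | h
  · rw [Set.indicator_of_notMem (by simpa using h), Set.indicator_of_notMem
      (by simp only [Set.mem_ofPred_eq, not_lt]; linarith), truncSq_of_le h,
      truncSq_of_le (h.trans (by linarith))]
    simp
  · rw [Set.indicator_of_mem (by simpa using h), truncSq_of_gt h]
    rcases le_or_gt |X ω| (2 * x) with h2 | h2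
    · rw [Set.indicator_of_notMem (by simpa using h2), truncSq_of_le h2, sub_zero, add_zero,
        le_div_iff₀ hx, ← sq_abs, sq]
      exact mul_le_mul_of_nonneg_left h.le (abs_nonneg _)
    · rw [Set.indicator_of_mem (by simpa using h2), truncSq_of_gt h2]
      simp

lemma eventually_mul_le_truncMoment (h_slow : SlowlyVarying (truncMoment μ X)) {l ε : ℝ}
    (hl : 0 < l) (hε : 0 < ε) :
    ∀ᶠ x in atTop, truncMoment μ X (l * x) ≤ (1 + ε) * truncMoment μ X x ∧
      (1 - ε) * truncMoment μ X x ≤ truncMoment μ X (l * x) := by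
  filter_upwards [h_slow.2.1, (h_slow.2.2 l hl).eventually_lt_const (by linarith : 1 < 1 + ε),
    (h_slow.2.2 l hl).eventually_const_lt (by linarith : 1 - ε < 1)] with x h0 h1 h2
  rw [div_lt_iff₀ h0] at h1
  rw [lt_div_iff₀ h0] at h2
  exact ⟨h1.le, h2.le⟩

/-- Summing over dyadic shells: by slow variation each shell carries little of the second moment,
and the factors `1 / (2 ^ N * x)` decay faster than the truncated moments can grow. -/
lemma eventually_tailMoment_le [IsFiniteMeasure μ] (hX : Measurable X) (hi : Integrable X μ)
    (h_slow : SlowlyVarying (truncMoment μ X)) {ε : ℝ} (hε : 0 < ε) :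
    ∀ᶠ x in atTop, x * tailMoment μ X x ≤ ε * truncMoment μ X x := by
  set δ := min (1 / 2) (ε / 4) with hδ
  have hδ0 : 0 < δ := by positivity
  have hδ1 : δ ≤ 1 / 2 := min_le_left _ _
  have hδ2 : δ ≤ ε / 4 := min_le_right _ _
  obtain ⟨x₀, hx₀⟩ := eventually_atTop.1
    (eventually_mul_le_truncMoment h_slow (two_pos) hδ0)
  filter_upwards [eventually_ge_atTop x₀, eventually_gt_atTop 0] with x hxx₀ hx
  -- The constant `4δ` reproduces itself: the first shell costs `δ`, and passing from `2y` to `y`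
  -- costs at most `2δ(1 + δ) ≤ 3δ` since `δ ≤ 1/2`.
  have key : ∀ N : ℕ, ∀ y, x₀ ≤ y → 0 < y →
      tailMoment μ X y ≤ 4 * δ * truncMoment μ X y / y + tailMoment μ X (2 ^ N * y) := by
    intro N
    induction N with
    | zero =>
      intro y _ hy
      have := truncMoment_nonneg (μ := μ) (X := X) y
      have : 0 ≤ 4 * δ * truncMoment μ X y / y := by positivity
      simpa using this
    | succ N ih =>
      intro y hy0 hy
      have h1 := tailMoment_le hX hi hy
      have h2 := ih (2 * y) (by linarith) (by linarith)
      have h3 := (hx₀ y hy0).1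
      have h0 := truncMoment_nonneg (μ := μ) (X := X) y
      rw [show (2 : ℝ) ^ (N + 1) * y = 2 ^ N * (2 * y) by ring]
      have h4 : (truncMoment μ X (2 * y) - truncMoment μ X y) / y +
          4 * δ * truncMoment μ X (2 * y) / (2 * y) ≤ 4 * δ * truncMoment μ X y / y := by
        have : 4 * δ * truncMoment μ X (2 * y) / (2 * y) =
            2 * δ * truncMoment μ X (2 * y) / y := by field_simp; ring
        rw [this, ← add_div]
        gcongr
        have h5 : 2 * δ * truncMoment μ X (2 * y) ≤ 2 * δ * (3 / 2 * truncMoment μ X y) := by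
          gcongr; exact h3.trans (by gcongr; linarith)
        linarith
      linarith
  have hlim : Tendsto (fun N : ℕ => 4 * δ * truncMoment μ X x / x +
      tailMoment μ X (2 ^ N * x)) atTop (𝓝 (4 * δ * truncMoment μ X x / x + 0)) := by
    refine tendsto_const_nhds.add ((tendsto_tailMoment hX hi).comp ?_)
    exact (tendsto_pow_atTop_atTop_of_one_lt one_lt_two).atTop_mul_const hx
  have h := ge_of_tendsto' hlim fun N => key N x hxx₀ hx
  rw [add_zero, le_div_iff₀ hx] at h
  have := truncMoment_nonneg (μ := μ) (X := X) x
  nlinarith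

/-- The truncated third absolute moment, `E (|X|³ I(|X| ≤ x))`. -/
def cubeMoment (μ : Measure Ω) (X : Ω → ℝ) (x : ℝ) : ℝ :=
  ∫ ω, |X ω| * truncSq X x ω ∂μ

lemma integrable_abs_mul_truncSq (hX : Measurable X) (hi : Integrable X μ) (x : ℝ) :
    Integrable (fun ω => |X ω| * truncSq X x ω) μ :=
  hi.abs.mul_bdd (c := x ^ 2) (measurable_truncSq hX x).aestronglyMeasurable
    (ae_of_all _ fun ω => by
      rw [Real.norm_eq_abs, abs_of_nonneg (truncSq_nonneg X x ω)]; exact truncSq_le_sq X x ω)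

/-- One factor `|X|` is bounded by `y` on the inner part and by `x` on the shell. With `y = δx`,
slow variation makes the shell negligible. -/
lemma cubeMoment_le [IsFiniteMeasure μ] (hX : Measurable X) (hi : Integrable X μ) {x y : ℝ} (hyx : y ≤ x) :
    cubeMoment μ X x ≤
      y * truncMoment μ X y + x * (truncMoment μ X x - truncMoment μ X y) := by
  have i1 := (integrable_truncSq (μ := μ) hX y).const_mul y
  have i2 : Integrable (fun ω => x * (truncSq X x ω - truncSq X y ω)) μ :=
    ((integrable_truncSq hX x).sub (integrable_truncSq hX y)).const_mul x
  rw [truncMoment, truncMoment, cubeMoment,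
    ← integral_sub (integrable_truncSq hX _) (integrable_truncSq hX _), ← integral_const_mul,
    ← integral_const_mul, ← integral_add i1 i2]
  refine integral_mono (integrable_abs_mul_truncSq hX hi x) (i1.add i2) fun ω => ?_
  beta_reduce
  have h0 := sq_nonneg (X ω)
  rcases le_or_gt |X ω| y with h | h
  · rw [truncSq_of_le h, truncSq_of_le (h.trans hyx)]
    nlinarith
  · rw [truncSq_of_gt h]
    rcases le_or_gt |X ω| x with h2 | h2
    · rw [truncSq_of_le h2]; nlinarith
    · rw [truncSq_of_gt h2]; simp

lemma eventually_cubeMoment_le [IsFiniteMeasure μ] (hX : Measurable X) (hi : Integrable X μ)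
    (h_slow : SlowlyVarying (truncMoment μ X)) {ε : ℝ} (hε : 0 < ε) :
    ∀ᶠ x in atTop, cubeMoment μ X x ≤ ε * x * truncMoment μ X x := by
  set δ := min 1 (ε / 2) with hδ
  have hδ0 : 0 < δ := by positivity
  have hδ1 : δ ≤ 1 := min_le_left _ _
  have hδ2 : δ ≤ ε / 2 := min_le_right _ _
  filter_upwards [eventually_mul_le_truncMoment h_slow hδ0 hδ0, eventually_gt_atTop 0]
    with x h hx
  have h1 := cubeMoment_le hX hi (mul_le_of_le_one_left hx.le hδ1)
  have h2 := truncMoment_mono (μ := μ) hX (mul_le_of_le_one_left hx.le hδ1)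
  have h3 := mul_le_mul_of_nonneg_left h2 (mul_pos hδ0 hx).le
  have h4 := mul_le_mul_of_nonneg_left h.2 hx.le
  have h5 := mul_le_mul_of_nonneg_right hδ2
    (mul_nonneg hx.le (truncMoment_nonneg (μ := μ) (X := X) x))
  linarith

lemma integral_clip_mul_sq (c : ℝ) :
    ∫ ω, clip (c * X ω) ^ 2 ∂μ = c ^ 2 * truncMoment μ X |c|⁻¹ := by
  simp_rw [clip_mul_sq]; rw [integral_const_mul, truncMoment]

lemma integral_abs_clip_mul_cube (c : ℝ) :
    ∫ ω, |clip (c * X ω)| ^ 3 ∂μ = |c| ^ 3 * cubeMoment μ X |c|⁻¹ := by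
  rw [cubeMoment, ← integral_const_mul]
  congr 1 with ω
  rcases le_or_gt |c * X ω| 1 with h | h
  · rw [pow_succ, sq_abs, clip_mul_sq, clip_of_le h, abs_mul, ← sq_abs c]; ring
  · have h0 := clip_mul_sq X c ω
    rw [clip_of_gt h] at h0 ⊢
    rw [pow_succ, sq_abs]
    rw [← sq_abs c] at h0
    linear_combination |c| * |X ω| * h0

lemma integral_abs_sub_clip_mul (c : ℝ) :
    ∫ ω, |c * X ω - clip (c * X ω)| ∂μ = |c| * tailMoment μ X |c|⁻¹ := by
  rw [tailMoment, ← integral_const_mul]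
  congr 1 with ω
  rcases eq_or_ne c 0 with rfl | hc
  · simp [clip]
  have hc' : 0 < |c| := abs_pos.2 hc
  rcases le_or_gt |X ω| |c|⁻¹ with h | h
  · have : |c * X ω| ≤ 1 := by
      rwa [abs_mul, ← le_inv_mul_iff₀ hc', mul_one]
    rw [clip_of_le this, Set.indicator_of_notMem (by simpa using h)]; simp
  · have : 1 < |c * X ω| := by
      rw [abs_mul]; rwa [inv_lt_iff_one_lt_mul₀' hc'] at h
    rw [clip_of_gt this, Set.indicator_of_mem (by simpa using h), sub_zero, abs_mul]

/-- Moment bounds for the clipped variable `c X` in terms of `c² H(1 / |c|)`, as `c → 0`. -/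
lemma eventually_clip_bounds [IsFiniteMeasure μ] (hX : Measurable X) (hi : Integrable X μ)
    (h_slow : SlowlyVarying (truncMoment μ X)) {ε : ℝ} (hε : 0 < ε) :
    ∀ᶠ c : ℝ in 𝓝 0,
      ∫ ω, clip (c * X ω) ^ 2 ∂μ = c ^ 2 * H μ X |c|⁻¹ ∧
      ∫ ω, |c * X ω - clip (c * X ω)| ∂μ ≤ ε * (c ^ 2 * H μ X |c|⁻¹) ∧
      ∫ ω, |clip (c * X ω)| ^ 3 ∂μ ≤ ε * (c ^ 2 * H μ X |c|⁻¹) := by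
  -- The asymptotics apply on the punctured neighbourhood; at `c = 0` all terms vanish.
  have hlim : Tendsto (fun c : ℝ => |c|⁻¹) (𝓝[≠] 0) atTop :=
    tendsto_inv_nhdsGT_zero.comp tendsto_abs_nhdsNE_zero
  have h := hlim.eventually ((eventually_tailMoment_le hX hi h_slow hε).and
    ((eventually_cubeMoment_le hX hi h_slow hε).and
      (eventually_ge_atTop (truncLevel μ X + 1))))
  rw [eventually_nhdsWithin_iff] at h
  filter_upwards [h] with c h
  rw [integral_clip_mul_sq, integral_abs_clip_mul_cube, integral_abs_sub_clip_mul]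
  rcases eq_or_ne c 0 with rfl | hc
  · simp
  obtain ⟨h1, h2, h3⟩ := h hc
  have hc' : 0 < |c| := abs_pos.2 hc
  rw [H_eq_truncMoment h3]
  refine ⟨rfl, ?_, ?_⟩
  · calc |c| * tailMoment μ X |c|⁻¹ = |c| ^ 2 * (|c|⁻¹ * tailMoment μ X |c|⁻¹) := by
          field_simp
      _ ≤ |c| ^ 2 * (ε * truncMoment μ X |c|⁻¹) := by gcongr
      _ = _ := by rw [sq_abs]; ring
  · calc |c| ^ 3 * cubeMoment μ X |c|⁻¹ ≤ |c| ^ 3 * (ε * |c|⁻¹ * truncMoment μ X |c|⁻¹) := by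
          gcongr
      _ = |c| ^ 2 * (ε * truncMoment μ X |c|⁻¹) := by field_simp
      _ = _ := by rw [sq_abs]; ring

end SlowVariation

/-! ### Variance of the sum of clipped squares. -/

section VarianceBound

lemma card_filter_near_le (s : Finset ℕ) (L j : ℕ) :
    (s.filter fun k => k ≤ j + L ∧ j ≤ k + L).card ≤ 2 * L + 1 := by
  calc _ ≤ (Finset.Icc (j - L) (j + L)).card := Finset.card_le_card fun k hk => by
        simp only [Finset.mem_filter, Finset.mem_Icc] at hk ⊢; omega
    _ ≤ _ := by rw [Nat.card_Icc]; omega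

/-- A bound for a symmetric double sum, separating pairs of indices by their distance. -/
lemma sum_sum_le_of_near_far {s : Finset ℕ} {A g : ℕ → ℕ → ℝ} {w : ℕ → ℝ} {L : ℕ} {ε η M : ℝ}
    (hε : 0 ≤ ε) (hη : 0 ≤ η) (hw : ∀ k ∈ s, 0 ≤ w k) (hM : ∑ k ∈ s, w k ≤ M)
    (hsymm : ∀ j k, A j k = A k j)
    (hnear : ∀ j ∈ s, ∀ k ∈ s, A j k ≤ ε * (w j + w k) / 2)
    (hfar : ∀ j ∈ s, ∀ k ∈ s, j + L < k → A j k ≤ w k * g j k)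
    (hg : ∀ k ∈ s, ∑ j ∈ s with j + L < k, g j k ≤ η) :
    ∑ j ∈ s, ∑ k ∈ s, A j k ≤ (ε * (2 * L + 1) + 2 * η) * M := by
  -- The two near conditions are equivalent; they are written differently so that exchanging the
  -- sums turns one term into the other. The two far terms are exchanged likewise.
  have hpt : ∀ j ∈ s, ∀ k ∈ s, A j k ≤
      ((if k ≤ j + L ∧ j ≤ k + L then ε / 2 * w j else 0) +
        (if j ≤ k + L ∧ k ≤ j + L then ε / 2 * w k else 0)) +
      ((if j + L < k then w k * g j k else 0) + (if k + L < j then w j * g k j else 0)) := by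
    intro j hj k hk
    by_cases h1 : j + L < k
    · rw [if_neg (by omega), if_neg (by omega), if_pos h1, if_neg (by omega)]
      linarith [hfar j hj k hk h1]
    by_cases h2 : k + L < j
    · rw [if_neg (by omega), if_neg (by omega), if_neg h1, if_pos h2, hsymm]
      linarith [hfar k hk j hj h2]
    rw [if_pos (by omega), if_pos (by omega), if_neg h1, if_neg h2]
    linarith [hnear j hj k hk]
  have hN : ∑ j ∈ s, ∑ k ∈ s, (if k ≤ j + L ∧ j ≤ k + L then ε / 2 * w j else 0) ≤
      ε / 2 * (2 * L + 1) * M := by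
    calc _ ≤ ∑ j ∈ s, ε / 2 * (2 * L + 1) * w j := Finset.sum_le_sum fun j hj => by
          rw [← Finset.sum_filter, Finset.sum_const, nsmul_eq_mul]
          have h1 : ((s.filter fun k => k ≤ j + L ∧ j ≤ k + L).card : ℝ) ≤ 2 * L + 1 := by
            exact_mod_cast card_filter_near_le s L j
          have := mul_le_mul_of_nonneg_right h1 (mul_nonneg (by linarith : (0 : ℝ) ≤ ε / 2) (hw j hj))
          linarith
      _ ≤ _ := by
          rw [← Finset.mul_sum]; gcongr
  have hF : ∑ k ∈ s, ∑ j ∈ s, (if j + L < k then w k * g j k else 0) ≤ η * M := by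
    calc _ ≤ ∑ k ∈ s, η * w k := Finset.sum_le_sum fun k hk => by
          rw [← Finset.sum_filter, ← Finset.mul_sum, mul_comm]
          exact mul_le_mul_of_nonneg_right (hg k hk) (hw k hk)
      _ ≤ _ := by rw [← Finset.mul_sum]; gcongr
  calc _ ≤ _ := Finset.sum_le_sum fun j hj => Finset.sum_le_sum fun k hk => hpt j hj k hk
    _ ≤ (ε / 2 * (2 * L + 1) * M + ε / 2 * (2 * L + 1) * M) + (η * M + η * M) := by
        simp only [Finset.sum_add_distrib]
        refine add_le_add (add_le_add hN ?_) (add_le_add ?_ hF)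
        · rw [Finset.sum_comm]; exact hN
        · rw [Finset.sum_comm]; exact hF
    _ = _ := by ring

variable {Ω : Type*} {mΩ : MeasurableSpace Ω} {μ : Measure Ω} {ξ : ℤ → Ω → ℝ}

lemma covariance_clip_sq (X Y : Ω → ℝ) (a b : ℝ) :
    cov[fun ω => clip (a * X ω) ^ 2, fun ω => clip (b * Y ω) ^ 2; μ] =
      a ^ 2 * b ^ 2 * cov[truncSq X |a|⁻¹, truncSq Y |b|⁻¹; μ] := by
  simp_rw [clip_mul_sq]
  rw [covariance_const_mul_left, covariance_const_mul_right, mul_assoc]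

lemma covariance_clip_sq_le_of_condM1 {ψ : ℕ → ℝ} {a b : ℝ} {j k : ℕ} (hjk : j < k)
    (h : ∀ a b : ℝ, 0 < a → 0 < b → ∀ (j : ℤ) (k : ℕ), 1 ≤ k →
      cov[truncSq (ξ j) a, truncSq (ξ (j + k)) b; μ] ≤
        ψ k * truncMoment μ (ξ 0) b * truncMoment μ (ξ 0) a) :
    cov[fun ω => clip (a * ξ j ω) ^ 2, fun ω => clip (b * ξ k ω) ^ 2; μ] ≤
      (b ^ 2 * truncMoment μ (ξ 0) |b|⁻¹) *
        (ψ (k - j) * (a ^ 2 * truncMoment μ (ξ 0) |a|⁻¹)) := by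
  rw [covariance_clip_sq]
  rcases eq_or_ne a 0 with rfl | ha
  · simp
  rcases eq_or_ne b 0 with rfl | hb
  · simp
  have h1 := h |a|⁻¹ |b|⁻¹ (by positivity) (by positivity) j (k - j) (by omega)
  rw [show (j : ℤ) + ((k - j : ℕ) : ℤ) = k by omega] at h1
  refine (mul_le_mul_of_nonneg_left h1 (by positivity)).trans_eq (by ring)

/-- The squared truncation level `|a|⁻²` of the earlier variable cancels its coefficient `a ^ 2`.
Only the weight of the later index survives, so summability of `φ` is what controls the sum over
`j`. -/
lemma covariance_clip_sq_le_of_condM2 {φ : ℕ → ℝ} {a b : ℝ} {j k : ℕ} (hjk : j < k)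
    (hφ : ∀ k, 0 < φ k)
    (h : ∀ a b : ℝ, 0 < a → 0 < b → ∀ (j : ℤ) (k : ℕ), 1 ≤ k →
      cov[truncSq (ξ j) a, truncSq (ξ (j + k)) b; μ] ≤
        a ^ 2 * φ k * truncMoment μ (ξ 0) b) :
    cov[fun ω => clip (a * ξ j ω) ^ 2, fun ω => clip (b * ξ k ω) ^ 2; μ] ≤
      (b ^ 2 * truncMoment μ (ξ 0) |b|⁻¹) * φ (k - j) := by
  rw [covariance_clip_sq]
  have hb0 := truncMoment_nonneg (μ := μ) (X := ξ 0) |b|⁻¹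
  rcases eq_or_ne a 0 with rfl | ha
  · have := hφ (k - j)
    simp only [ne_eq, OfNat.ofNat_ne_zero, not_false_eq_true, zero_pow, zero_mul]
    positivity
  rcases eq_or_ne b 0 with rfl | hb
  · simp
  have h1 := h |a|⁻¹ |b|⁻¹ (by positivity) (by positivity) j (k - j) (by omega)
  rw [show (j : ℤ) + ((k - j : ℕ) : ℤ) = k by omega] at h1
  refine (mul_le_mul_of_nonneg_left h1 (by positivity)).trans_eq ?_
  rw [inv_pow, sq_abs]
  field_simp

/-- Under either mixing condition, covariances at large lags are summably small. -/
lemma exists_lag_bound (h_mix : CondM1 μ ξ ∨ CondM2 μ ξ) {M η : ℝ} (hM : 0 ≤ M) (hη : 0 < η) :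
    ∃ L : ℕ, ∀ (s : Finset ℕ) (c : ℕ → ℝ),
      ∑ k ∈ s, c k ^ 2 * truncMoment μ (ξ 0) |c k|⁻¹ ≤ M →
      ∃ g : ℕ → ℕ → ℝ,
        (∀ j k, j + L < k →
          cov[fun ω => clip (c j * ξ j ω) ^ 2, fun ω => clip (c k * ξ k ω) ^ 2; μ] ≤
            (c k ^ 2 * truncMoment μ (ξ 0) |c k|⁻¹) * g j k) ∧
        ∀ k, ∑ j ∈ s with j + L < k, g j k ≤ η := by
  rcases h_mix with ⟨ψ, -, hψ, h⟩ | ⟨φ, hφ0, hφ, h⟩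
  -- Under the first condition smallness of `ψ` suffices, since the earlier indices carry weights of
  -- total at most `M`.
  · obtain ⟨L, hL⟩ := eventually_atTop.1
      (hψ.eventually_le_const (show 0 < η / (M + 1) by positivity))
    refine ⟨L, fun s c hs => ⟨_, fun j k hjk =>
      covariance_clip_sq_le_of_condM1 (by omega) h, fun k => ?_⟩⟩
    have hw j : 0 ≤ c j ^ 2 * truncMoment μ (ξ 0) |c j|⁻¹ :=
      mul_nonneg (sq_nonneg _) (truncMoment_nonneg _)
    calc _ ≤ ∑ j ∈ s with j + L < k, η / (M + 1) * (c j ^ 2 * truncMoment μ (ξ 0) |c j|⁻¹) :=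
          Finset.sum_le_sum fun j hj => mul_le_mul_of_nonneg_right
            (hL _ (by have := (Finset.mem_filter.1 hj).2; omega)) (hw j)
      _ ≤ ∑ j ∈ s, η / (M + 1) * (c j ^ 2 * truncMoment μ (ξ 0) |c j|⁻¹) :=
          Finset.sum_le_sum_of_subset_of_nonneg (Finset.filter_subset _ _)
            fun j _ _ => mul_nonneg (by positivity) (hw j)
      _ ≤ η / (M + 1) * (M + 1) := by
          rw [← Finset.mul_sum]
          exact mul_le_mul_of_nonneg_left (by linarith) (by positivity)
      _ = η := by field_simp
  · obtain ⟨L, hL⟩ := eventually_atTop.1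
      ((tendsto_sum_nat_add φ).eventually_le_const hη)
    refine ⟨L, fun s c _ => ⟨fun j k => φ (k - j), fun j k hjk =>
      covariance_clip_sq_le_of_condM2 (by omega) hφ0 h, fun k => ?_⟩⟩
    -- Distinct `j` give distinct lags beyond `L`, so the sum is part of a tail of the series of
    -- `φ`.
    have hinj : Set.InjOn (fun j => k - j - L) (s.filter fun j => j + L < k) := by
      intro i hi j hj hij
      have hi := (Finset.mem_filter.1 hi).2
      have hj := (Finset.mem_filter.1 hj).2
      simp only at hij
      omega
    calc _ = ∑ j ∈ s with j + L < k, φ (k - j - L + L) := Finset.sum_congr rfl fun j hj => by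
          have := (Finset.mem_filter.1 hj).2
          rw [Nat.sub_add_cancel (by omega)]
      _ = ∑ i ∈ (s.filter fun j => j + L < k).image (fun j => k - j - L), φ (i + L) := by
          rw [Finset.sum_image hinj]
      _ ≤ ∑' i, φ (i + L) := Summable.sum_le_tsum _ (fun i _ => (hφ0 _).le)
          ((summable_nat_add_iff L).2 hφ)
      _ ≤ η := hL L le_rfl

variable [IsProbabilityMeasure μ]

/-- Nonnegativity of the variance of `X - Y`. -/
lemma covariance_le_half_add_variance {X Y : Ω → ℝ} (hX : MemLp X 2 μ) (hY : MemLp Y 2 μ) :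
    cov[X, Y; μ] ≤ (Var[X; μ] + Var[Y; μ]) / 2 := by
  have h1 := variance_sub hX hY
  have h2 := variance_nonneg (X - Y) μ
  linarith

lemma memLp_clip_sq {X : Ω → ℝ} (hX : Measurable X) (c : ℝ) (p : ENNReal) :
    MemLp (fun ω => clip (c * X ω) ^ 2) p μ :=
  MemLp.of_bound ((measurable_clip.comp (hX.const_mul c)).pow_const 2).aestronglyMeasurable 1
    (ae_of_all _ fun ω => by
      rw [Real.norm_eq_abs, abs_pow]; exact pow_le_one₀ (abs_nonneg _) (abs_clip_le _))

lemma integrable_abs_clip_cube {X : Ω → ℝ} (hX : Measurable X) (c : ℝ) :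
    Integrable (fun ω => |clip (c * X ω)| ^ 3) μ :=
  Integrable.of_bound
    ((measurable_clip.comp (hX.const_mul c)).abs.pow_const 3).aestronglyMeasurable 1
    (ae_of_all _ fun ω => by
      rw [Real.norm_eq_abs, abs_pow, abs_abs]; exact pow_le_one₀ (abs_nonneg _) (abs_clip_le _))

lemma variance_clip_sq_le {X : Ω → ℝ} (hX : Measurable X) (c : ℝ) :
    Var[fun ω => clip (c * X ω) ^ 2; μ] ≤ ∫ ω, |clip (c * X ω)| ^ 3 ∂μ := by
  refine (variance_le_expectation_sq (memLp_clip_sq hX c 2).aestronglyMeasurable).trans ?_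
  refine integral_mono (memLp_clip_sq hX c 2).integrable_sq (integrable_abs_clip_cube hX c)
    fun ω => ?_
  have h : ((fun ω => clip (c * X ω) ^ 2) ^ 2) ω = |clip (c * X ω)| ^ 4 := by
    simp only [Pi.pow_apply]
    rw [Even.pow_abs (by decide)]; ring
  refine h.le.trans ?_
  exact pow_le_pow_of_le_one (abs_nonneg _) (abs_clip_le _) (by norm_num)

/-- The sum of the squared clipped variables has small variance if the coefficients are small. -/
lemma exists_variance_sum_clip_sq_le (hξ : ∀ k, Measurable (ξ k)) (hi : Integrable (ξ 0) μ)
    (h_ident : ∀ k, IdentDistrib (ξ k) (ξ 0) μ μ)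
    (h_slow : SlowlyVarying (truncMoment μ (ξ 0))) (h_mix : CondM1 μ ξ ∨ CondM2 μ ξ)
    {M ε : ℝ} (hM : 0 ≤ M) (hε : 0 < ε) :
    ∃ δ > 0, ∀ (s : Finset ℕ) (c : ℕ → ℝ), (∀ k ∈ s, |c k| < δ) →
      ∑ k ∈ s, c k ^ 2 * H μ (ξ 0) |c k|⁻¹ ≤ M →
      Var[fun ω => ∑ k ∈ s, clip (c k * ξ k ω) ^ 2; μ] ≤ ε := by
  -- Far pairs receive `ε / 2` and near pairs `ε / 2`. The lag `L` is fixed first, because the near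
  -- tolerance must absorb the `2 * L + 1` neighbours of each index.
  have hη : 0 < ε / (4 * (M + 1)) := by positivity
  obtain ⟨L, hL⟩ := exists_lag_bound h_mix hM hη
  have hκ : 0 < ε / (2 * (2 * L + 1) * (M + 1)) := by positivity
  obtain ⟨δ, hδ0, hδ⟩ := Metric.eventually_nhds_iff.1
    (eventually_clip_bounds (hξ 0) hi h_slow hκ)
  refine ⟨δ, hδ0, fun s c hc hs => ?_⟩
  have hb k (hk : k ∈ s) := hδ (y := c k) (by simpa using hc k hk)
  have hwH : ∀ k ∈ s, c k ^ 2 * truncMoment μ (ξ 0) |c k|⁻¹ = c k ^ 2 * H μ (ξ 0) |c k|⁻¹ :=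
    fun k hk => by rw [← (hb k hk).1, integral_clip_mul_sq]
  have hs' : ∑ k ∈ s, c k ^ 2 * truncMoment μ (ξ 0) |c k|⁻¹ ≤ M := by
    rwa [Finset.sum_congr rfl hwH]
  obtain ⟨g, hg1, hg2⟩ := hL s c hs'
  rw [variance_fun_sum' fun (k : ℕ) _ => memLp_clip_sq (hξ k) (c k) 2]
  have hvar : ∀ k ∈ s, Var[fun ω => clip (c k * ξ k ω) ^ 2; μ] ≤
      ε / (2 * (2 * L + 1) * (M + 1)) * (c k ^ 2 * truncMoment μ (ξ 0) |c k|⁻¹) := by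
    intro k hk
    refine (variance_clip_sq_le (hξ k) (c k)).trans ?_
    rw [hwH k hk]
    refine le_of_eq_of_le ?_ (hb k hk).2.2
    exact ((h_ident k).comp (u := fun x => |clip (c k * x)| ^ 3)
      ((measurable_clip.comp (measurable_const_mul _)).abs.pow_const 3)).integral_eq
  refine (sum_sum_le_of_near_far (L := L) (g := g) hκ.le hη.le
    (fun k _ => mul_nonneg (sq_nonneg _) (truncMoment_nonneg _)) hs'
    (fun j k => covariance_comm _ _) (fun j hj k hk => ?_)
    (fun j _ k _ hjk => hg1 j k hjk) (fun k _ => hg2 k)).trans ?_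
  · have := covariance_le_half_add_variance (memLp_clip_sq (μ := μ) (hξ j) (c j) 2)
      (memLp_clip_sq (μ := μ) (hξ k) (c k) 2)
    linarith [hvar j hj, hvar k hk]
  · have : (ε / (2 * (2 * L + 1) * (M + 1)) * (2 * L + 1) + 2 * (ε / (4 * (M + 1)))) * (M + 1) =
        ε := by field_simp; ring
    exact (mul_le_mul_of_nonneg_left (by linarith : M ≤ M + 1) (by positivity)).trans_eq this

end VarianceBound

/-! ### Limits along the rows of the array. -/

section TriangularArray

variable {Ω : Type*} {mΩ : MeasurableSpace Ω} {μ : Measure Ω} {ξ : ℤ → Ω → ℝ}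
  {m : ℕ → ℕ} {c : ℕ → ℕ → ℝ}

lemma integral_comp_mul_eq (h_ident : ∀ k, IdentDistrib (ξ k) (ξ 0) μ μ)
    {f : ℝ → ℝ} (hf : Measurable f) (a : ℝ) (k : ℤ) :
    ∫ ω, f (a * ξ k ω) ∂μ = ∫ ω, f (a * ξ 0 ω) ∂μ :=
  ((h_ident k).comp (u := fun x => f (a * x)) (hf.comp (measurable_const_mul a))).integral_eq

lemma exists_sum_weight_le (h_sup : BddAbove (Set.range fun n =>
      ∑ k ∈ Finset.Icc 1 (m n), weight μ (ξ 0) c n k)) : ∃ M, 0 ≤ M ∧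
    ∀ n, ∑ k ∈ Finset.Icc 1 (m n), weight μ (ξ 0) c n k ≤ M := by
  obtain ⟨M, hM⟩ := h_sup
  exact ⟨max M 0, le_max_right _ _, fun n => (hM ⟨n, rfl⟩).trans (le_max_left _ _)⟩

lemma tendsto_sum_of_eventually_le (h_sup : BddAbove (Set.range fun n =>
      ∑ k ∈ Finset.Icc 1 (m n), weight μ (ξ 0) c n k)) {F : ℕ → ℕ → ℝ} (hF : ∀ n k, 0 ≤ F n k)
    (h : ∀ ε : ℝ, 0 < ε → ∀ᶠ n in atTop, ∀ k ∈ Finset.Icc 1 (m n),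
      F n k ≤ ε * weight μ (ξ 0) c n k) :
    Tendsto (fun n => ∑ k ∈ Finset.Icc 1 (m n), F n k) atTop (𝓝 0) := by
  obtain ⟨M, hM0, hM⟩ := exists_sum_weight_le h_sup
  refine tendsto_order.2 ⟨fun a ha => Eventually.of_forall fun n =>
    ha.trans_le (Finset.sum_nonneg fun k _ => hF n k), fun a ha => ?_⟩
  have hε : 0 < a / (M + 1) := by positivity
  filter_upwards [h _ hε] with n hn
  calc _ ≤ ∑ k ∈ Finset.Icc 1 (m n), a / (M + 1) * weight μ (ξ 0) c n k :=
        Finset.sum_le_sum hn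
    _ ≤ a / (M + 1) * M := by rw [← Finset.mul_sum]; gcongr; exact hM n
    _ < a / (M + 1) * (M + 1) := by gcongr; linarith
    _ = a := by field_simp

lemma tendstoInMeasure_of_sub_of_tendsto [IsFiniteMeasure μ] {f : ℕ → Ω → ℝ} {a : ℕ → ℝ} {l : ℝ}
    (hf : TendstoInMeasure μ (fun n ω => f n ω - a n) atTop (fun _ => (0 : ℝ)))
    (ha : Tendsto a atTop (𝓝 l)) : TendstoInMeasure μ f atTop (fun _ => l) := by
  rw [tendstoInMeasure_iff_measureReal_norm] at hf ⊢
  intro δ hδ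
  refine squeeze_zero' (Eventually.of_forall fun _ => measureReal_nonneg) ?_
    (hf (δ / 2) (by positivity))
  filter_upwards [Metric.tendsto_nhds.1 ha (δ / 2) (by positivity)] with n hn
  refine measureReal_mono fun ω hω => ?_
  simp only [Set.mem_ofPred_eq, sub_zero, Real.norm_eq_abs, Real.dist_eq] at hω hn ⊢
  have := abs_sub_le (f n ω) (a n) l
  linarith

lemma sum_range_comp_succ (f : ℕ → ℝ) (n : ℕ) :
    ∑ k ∈ Finset.range n, f (k + 1) = ∑ k ∈ Finset.Icc 1 n, f k := by
  rw [Finset.range_eq_Ico, Finset.sum_Ico_add' f 0 n 1]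
  congr 1

/-- The restriction to the natural numbers of a filtration indexed by the integers. -/
def natFiltration (ℱ : Filtration ℤ mΩ) : Filtration ℕ mΩ where
  seq k := ℱ k
  mono' _ _ h := ℱ.mono (by exact_mod_cast h)
  le' k := ℱ.le k

variable [IsProbabilityMeasure μ]

/-- Integrates `|z| ≤ ε/2 + z²/(2ε)`. -/
lemma integral_abs_le_of_integral_sq_le {Z : Ω → ℝ} (hZ : MemLp Z 2 μ) {ε : ℝ} (hε : 0 < ε)
    (h : ∫ ω, Z ω ^ 2 ∂μ ≤ ε ^ 2) : ∫ ω, |Z ω| ∂μ ≤ ε := by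
  have i1 := hZ.integrable_sq
  calc ∫ ω, |Z ω| ∂μ ≤ ∫ ω, (ε / 2 + (2 * ε)⁻¹ * Z ω ^ 2) ∂μ := by
        refine integral_mono (hZ.integrable one_le_two).abs
          ((integrable_const _).add (i1.const_mul _)) fun ω => ?_
        beta_reduce
        rw [← sq_abs (Z ω)]
        have h1 : 0 ≤ (2 * ε)⁻¹ * (|Z ω| - ε) ^ 2 := by positivity
        have h2 : (2 * ε)⁻¹ * (|Z ω| - ε) ^ 2 =
            ε / 2 + (2 * ε)⁻¹ * |Z ω| ^ 2 - |Z ω| := by field_simp; ring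
        linarith
    _ = ε / 2 + (2 * ε)⁻¹ * ∫ ω, Z ω ^ 2 ∂μ := by
        rw [integral_add (integrable_const _) (i1.const_mul _), integral_const_mul]; simp
    _ ≤ ε / 2 + (2 * ε)⁻¹ * ε ^ 2 := by gcongr
    _ = ε := by field_simp; ring

/-- Since `H ≥ 1`, each weight dominates the square of its coefficient. -/
lemma eventually_abs_coeff_lt (hξ : Measurable (ξ 0))
    (h_inf : ∫⁻ ω, ENNReal.ofReal (ξ 0 ω ^ 2) ∂μ = ⊤)
    (h_max : Tendsto (fun n => ⨆ k : Finset.Icc 1 (m n), weight μ (ξ 0) c n k) atTop (𝓝 0))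
    {δ : ℝ} (hδ : 0 < δ) : ∀ᶠ n in atTop, ∀ k ∈ Finset.Icc 1 (m n), |c n k| < δ := by
  filter_upwards [h_max.eventually_lt_const (show 0 < δ ^ 2 by positivity)] with n hn k hk
  have h1 : weight μ (ξ 0) c n k ≤ ⨆ k : Finset.Icc 1 (m n), weight μ (ξ 0) c n k :=
    le_ciSup (f := fun k : Finset.Icc 1 (m n) => weight μ (ξ 0) c n k)
      (Set.finite_range _).bddAbove ⟨k, hk⟩
  have h2 : c n k ^ 2 ≤ weight μ (ξ 0) c n k :=
    le_mul_of_one_le_right (sq_nonneg _) (one_le_H hξ h_inf _)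
  exact lt_of_pow_lt_pow_left₀ 2 hδ.le (by rw [sq_abs]; linarith)

variable (hξ : ∀ k, Measurable (ξ k)) (hi : ∀ k, Integrable (ξ k) μ)
  (h_ident : ∀ k, IdentDistrib (ξ k) (ξ 0) μ μ)
  (h_inf : ∫⁻ ω, ENNReal.ofReal (ξ 0 ω ^ 2) ∂μ = ⊤)
  (h_slow : SlowlyVarying (truncMoment μ (ξ 0)))
  (h_sup : BddAbove (Set.range fun n => ∑ k ∈ Finset.Icc 1 (m n), weight μ (ξ 0) c n k))
  (h_max : Tendsto (fun n => ⨆ k : Finset.Icc 1 (m n), weight μ (ξ 0) c n k) atTop (𝓝 0))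

include hξ hi h_ident h_inf h_slow h_max in
/-- Eventually, all clipped moments in a row are controlled by the weights. -/
lemma eventually_row_bounds {ε : ℝ} (hε : 0 < ε) :
    ∀ᶠ n in atTop, ∀ k ∈ Finset.Icc 1 (m n),
      ∫ ω, clip (c n k * ξ k ω) ^ 2 ∂μ = weight μ (ξ 0) c n k ∧
      ∫ ω, |c n k * ξ k ω - clip (c n k * ξ k ω)| ∂μ ≤ ε * weight μ (ξ 0) c n k ∧
      ∫ ω, |clip (c n k * ξ k ω)| ^ 3 ∂μ ≤ ε * weight μ (ξ 0) c n k := by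
  obtain ⟨δ, hδ0, hδ⟩ := Metric.eventually_nhds_iff.1
    (eventually_clip_bounds (hξ 0) (hi 0) h_slow hε)
  filter_upwards [eventually_abs_coeff_lt (hξ 0) h_inf h_max hδ0] with n hn k hk
  rw [integral_comp_mul_eq h_ident (measurable_clip.pow_const 2),
    integral_comp_mul_eq h_ident (f := fun x => |x - clip x|)
      (measurable_id.sub measurable_clip).abs,
    integral_comp_mul_eq h_ident (f := fun x => |clip x| ^ 3)
      (measurable_clip.abs.pow_const 3)]
  exact hδ (y := c n k) (by simpa using hn k hk)

include hξ hi h_ident h_inf h_slow h_sup h_max in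
lemma tendsto_sum_integral_abs_sub_clip :
    Tendsto (fun n => ∑ k ∈ Finset.Icc 1 (m n),
      ∫ ω, |c n k * ξ k ω - clip (c n k * ξ k ω)| ∂μ) atTop (𝓝 0) :=
  tendsto_sum_of_eventually_le h_sup (fun _ _ => integral_nonneg fun _ => abs_nonneg _)
    fun _ hε => (eventually_row_bounds hξ hi h_ident h_inf h_slow h_max hε).mono
      fun _ h k hk => (h k hk).2.1

include hξ hi h_ident h_inf h_slow h_sup h_max in
lemma tendsto_sum_integral_abs_clip_cube :
    Tendsto (fun n => ∑ k ∈ Finset.Icc 1 (m n),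
      ∫ ω, |clip (c n k * ξ k ω)| ^ 3 ∂μ) atTop (𝓝 0) :=
  tendsto_sum_of_eventually_le h_sup (fun _ _ => integral_nonneg fun _ => by positivity)
    fun _ hε => (eventually_row_bounds hξ hi h_ident h_inf h_slow h_max hε).mono
      fun _ h k hk => (h k hk).2.2

include hξ hi h_ident h_inf h_slow h_sup h_max in
/-- The clipped sums of squares are asymptotic in `L¹` to the sums of the weights. -/
lemma tendsto_integral_abs_sum_clip_sq_sub (h_mix : CondM1 μ ξ ∨ CondM2 μ ξ) :
    Tendsto (fun n => ∫ ω, |∑ k ∈ Finset.Icc 1 (m n), clip (c n k * ξ k ω) ^ 2 -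
      ∑ k ∈ Finset.Icc 1 (m n), weight μ (ξ 0) c n k| ∂μ) atTop (𝓝 0) := by
  obtain ⟨M, hM0, hM⟩ := exists_sum_weight_le h_sup
  refine tendsto_order.2 ⟨fun a ha => Eventually.of_forall fun n =>
    ha.trans_le (integral_nonneg fun _ => abs_nonneg _), fun a ha => ?_⟩
  have ha2 : 0 < a / 2 := by positivity
  obtain ⟨δ, hδ0, hδ⟩ := exists_variance_sum_clip_sq_le hξ (hi 0) h_ident h_slow h_mix hM0
    (pow_pos ha2 2)
  filter_upwards [eventually_abs_coeff_lt (hξ 0) h_inf h_max hδ0,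
    eventually_row_bounds hξ hi h_ident h_inf h_slow h_max one_pos] with n hn hrow
  have hL : MemLp (fun ω => ∑ k ∈ Finset.Icc 1 (m n), clip (c n k * ξ k ω) ^ 2) 2 μ :=
    memLp_finsetSum _ fun k _ => memLp_clip_sq (hξ k) (c n k) 2
  have hE : ∫ ω, ∑ k ∈ Finset.Icc 1 (m n), clip (c n k * ξ k ω) ^ 2 ∂μ =
      ∑ k ∈ Finset.Icc 1 (m n), weight μ (ξ 0) c n k := by
    rw [integral_finsetSum _ fun (k : ℕ) _ =>
      memLp_one_iff_integrable.1 (memLp_clip_sq (hξ k) (c n k) 1)]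
    exact Finset.sum_congr rfl fun k hk => (hrow k hk).1
  have hvar := hδ _ (c n) hn (hM n)
  rw [variance_eq_integral hL.aemeasurable, hE] at hvar
  refine (integral_abs_le_of_integral_sq_le (hL.sub (memLp_const _)) ha2 hvar).trans_lt ?_
  linarith

include hξ hi h_ident h_inf h_slow h_sup h_max in
lemma tendstoInMeasure_sum_sq_sub (h_mix : CondM1 μ ξ ∨ CondM2 μ ξ) :
    TendstoInMeasure μ
      (fun n ω => (∑ k ∈ Finset.Icc 1 (m n), c n k ^ 2 * ξ k ω ^ 2)
        - (∑ k ∈ Finset.Icc 1 (m n), weight μ (ξ 0) c n k)) atTop (fun _ => (0 : ℝ)) := by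
  rw [tendstoInMeasure_iff_measureReal_norm]
  intro δ hδ
  have h1 := tendsto_sum_integral_abs_sub_clip hξ hi h_ident h_inf h_slow h_sup h_max
  have h2 := tendsto_integral_abs_sum_clip_sq_sub hξ hi h_ident h_inf h_slow h_sup h_max h_mix
  have h3 := h1.add (h2.const_mul δ⁻¹)
  rw [mul_zero, add_zero] at h3
  refine squeeze_zero (fun _ => measureReal_nonneg) (fun n => ?_) h3
  set V : Ω → ℝ := fun ω => |∑ k ∈ Finset.Icc 1 (m n), clip (c n k * ξ k ω) ^ 2 -
      ∑ k ∈ Finset.Icc 1 (m n), weight μ (ξ 0) c n k| with hV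
  set U : Ω → ℝ := fun ω => ∑ k ∈ Finset.Icc 1 (m n),
    |c n k * ξ k ω - clip (c n k * ξ k ω)| with hU
  have iu (k : ℕ) : Integrable (fun ω => |c n k * ξ k ω - clip (c n k * ξ k ω)|) μ :=
    (((hi k).const_mul _).sub (integrable_clip_comp ((hξ k).const_mul _))).abs
  have iU : Integrable U μ := integrable_finsetSum _ fun k _ => iu k
  have iV : Integrable V μ := by
    refine ((integrable_finsetSum _ fun (k : ℕ) _ => ?_).sub (integrable_const _)).abs
    exact memLp_one_iff_integrable.1 (memLp_clip_sq (hξ k) (c n k) 1)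
  have hU0 ω : 0 ≤ U ω := Finset.sum_nonneg fun _ _ => abs_nonneg _
  have hV0 ω : 0 ≤ V ω := abs_nonneg _
  have iW : Integrable (fun ω => U ω + δ⁻¹ * V ω) μ := iU.add (iV.const_mul _)
  -- A single Markov inequality at level `1` covers both cases: if some `|c n k * ξ k ω|` exceeds
  -- `1`, then so does `U ω`; otherwise clipping is inactive and a deviation of size `δ` means `V ω
  -- ≥ δ`.
  have hmarkov := mul_meas_ge_le_integral_of_nonneg (μ := μ) (f := fun ω => U ω + δ⁻¹ * V ω)
    (ae_of_all _ fun ω => add_nonneg (hU0 ω) (mul_nonneg (by positivity) (hV0 ω))) iW 1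
  rw [one_mul, integral_add iU (iV.const_mul _), integral_const_mul,
    integral_finsetSum _ fun k _ => iu k] at hmarkov
  refine (measureReal_mono fun ω hω => ?_).trans hmarkov
  simp only [Set.mem_ofPred_eq, sub_zero, Real.norm_eq_abs] at hω ⊢
  by_cases hall : ∀ k ∈ Finset.Icc 1 (m n), |c n k * ξ k ω| ≤ 1
  · have : V ω = |∑ k ∈ Finset.Icc 1 (m n), c n k ^ 2 * ξ k ω ^ 2 -
        ∑ k ∈ Finset.Icc 1 (m n), weight μ (ξ 0) c n k| := by
      rw [hV]; dsimp only
      rw [Finset.sum_congr rfl fun k hk => by rw [clip_of_le (hall k hk), mul_pow]]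
    rw [← this] at hω
    have h4 : 1 ≤ δ⁻¹ * V ω := by
      rw [← inv_mul_cancel₀ hδ.ne']; gcongr
    linarith [hU0 ω]
  · push Not at hall
    obtain ⟨k, hk, hgt⟩ := hall
    have h4 : |c n k * ξ k ω - clip (c n k * ξ k ω)| ≤ U ω :=
      Finset.single_le_sum (f := fun k : ℕ => |c n k * ξ k ω - clip (c n k * ξ k ω)|)
        (fun _ _ => abs_nonneg _) hk
    rw [clip_of_gt hgt, sub_zero] at h4
    have := mul_nonneg (inv_nonneg.2 hδ.le) (hV0 ω)
    linarith

/-- Reindexes the general bound: the `k`-th increment is `a (k + 1) * ξ (k + 1)`, which is known at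
time `k + 1` and centered given time `k`. -/
lemma norm_charFun_sub_le {ℱ : Filtration ℤ mΩ} (h_mds : IsMartingaleDiff μ ℱ ξ)
    (a : ℕ → ℝ) (t : ℝ) (n : ℕ) :
    ‖∫ ω, Complex.exp ((t * ∑ k ∈ Finset.Icc 1 n, a k * ξ k ω : ℝ) * Complex.I) ∂μ -
      (Real.exp (-(t ^ 2 / 2)) : ℝ)‖ ≤
      (|t| + |t| * Real.exp (2 * t ^ 2)) *
        ∑ k ∈ Finset.Icc 1 n, ∫ ω, |a k * ξ k ω - clip (a k * ξ k ω)| ∂μ +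
      4 * |t| ^ 3 * ∑ k ∈ Finset.Icc 1 n, ∫ ω, |clip (a k * ξ k ω)| ^ 3 ∂μ +
      (2 + Real.exp (2 * t ^ 2) * t ^ 2) *
        ∫ ω, |∑ k ∈ Finset.Icc 1 n, clip (a k * ξ k ω) ^ 2 - 1| ∂μ := by
  have hce (k : ℕ) : μ[fun ω => a (k + 1) * ξ ((k + 1 : ℕ) : ℤ) ω | natFiltration ℱ k]
      =ᵐ[μ] 0 := by
    have h1 := h_mds.condExp_eq_zero ((k + 1 : ℕ) : ℤ)
    rw [show (((k + 1 : ℕ) : ℤ) - 1) = k by push_cast; ring] at h1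
    refine (condExp_smul (a (k + 1)) (ξ ((k + 1 : ℕ) : ℤ)) (ℱ k)).trans ?_
    filter_upwards [h1] with ω hω
    rw [Pi.smul_apply, hω]; simp
  have h := norm_integral_exp_sum_sub_le (μ := μ) (natFiltration ℱ)
    (X := fun k ω => a (k + 1) * ξ ((k + 1 : ℕ) : ℤ) ω)
    (fun k => (h_mds.adapted _).const_mul _) (fun k => (h_mds.integrable _).const_mul _) hce t n
  have e1 ω := sum_range_comp_succ (fun k => a k * ξ k ω) n
  have e2 ω := sum_range_comp_succ (fun k => clip (a k * ξ k ω) ^ 2) n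
  have e3 := sum_range_comp_succ (fun k => ∫ ω, |a k * ξ k ω - clip (a k * ξ k ω)| ∂μ) n
  have e4 := sum_range_comp_succ (fun k => ∫ ω, |clip (a k * ξ k ω)| ^ 3 ∂μ) n
  simp only [clipQV, e1, e2, e3, e4] at h
  exact h

include h_ident h_inf h_slow h_sup h_max in
lemma tendstoInDistribution_sum {ℱ : Filtration ℤ mΩ} (h_mds : IsMartingaleDiff μ ℱ ξ)
    (h_mix : CondM1 μ ξ ∨ CondM2 μ ξ)
    (h_one : Tendsto (fun n => ∑ k ∈ Finset.Icc 1 (m n), weight μ (ξ 0) c n k) atTop (𝓝 1)) :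
    TendstoInDistribution (fun n ω => ∑ k ∈ Finset.Icc 1 (m n), c n k * ξ k ω)
      atTop (id : ℝ → ℝ) (fun _ => μ) (gaussianReal 0 1) := by
  have hξ k : Measurable (ξ k) := (h_mds.adapted k).mono (ℱ.le k) le_rfl
  have hi := h_mds.integrable
  have hS n : Measurable fun ω => ∑ k ∈ Finset.Icc 1 (m n), c n k * ξ k ω :=
    Finset.measurable_fun_sum _ fun k _ => (hξ k).const_mul _
  refine ⟨fun n => (hS n).aemeasurable, aemeasurable_id, ?_⟩
  refine ProbabilityMeasure.tendsto_iff_tendsto_charFun.2 fun t => ?_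
  have hgauss : charFun ((gaussianReal 0 1).map id) t = (Real.exp (-(t ^ 2 / 2)) : ℝ) := by
    rw [Measure.map_id, charFun_gaussianReal]
    push_cast
    congr 1; ring
  have hchar n : charFun (μ.map fun ω => ∑ k ∈ Finset.Icc 1 (m n), c n k * ξ k ω) t =
      ∫ ω, Complex.exp ((t * ∑ k ∈ Finset.Icc 1 (m n), c n k * ξ k ω : ℝ) * Complex.I) ∂μ := by
    rw [charFun_apply_real, integral_map (hS n).aemeasurable (by fun_prop)]
    push_cast
    rfl
  change Tendsto (fun n => charFun
    (μ.map fun ω => ∑ k ∈ Finset.Icc 1 (m n), c n k * ξ k ω) t) atTop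
    (𝓝 (charFun ((gaussianReal 0 1).map id) t))
  simp only [hgauss, hchar]
  rw [tendsto_iff_norm_sub_tendsto_zero]
  have h1 := tendsto_sum_integral_abs_sub_clip hξ hi h_ident h_inf h_slow h_sup h_max
  have h2 := tendsto_sum_integral_abs_clip_cube hξ hi h_ident h_inf h_slow h_sup h_max
  have h3 := tendsto_integral_abs_sum_clip_sq_sub hξ hi h_ident h_inf h_slow h_sup h_max h_mix
  -- The normalization moves the centering from the sum of weights to `1`, the form required by the
  -- characteristic function bound.
  have h4 : Tendsto (fun n => ∫ ω, |∑ k ∈ Finset.Icc 1 (m n), clip (c n k * ξ k ω) ^ 2 - 1| ∂μ)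
      atTop (𝓝 0) := by
    have h5 := h3.add (tendsto_iff_norm_sub_tendsto_zero.1 h_one)
    rw [add_zero] at h5
    refine squeeze_zero (fun _ => integral_nonneg fun _ => abs_nonneg _) (fun n => ?_) h5
    have iY : Integrable (fun ω => ∑ k ∈ Finset.Icc 1 (m n), clip (c n k * ξ k ω) ^ 2) μ :=
      integrable_finsetSum _ fun (k : ℕ) _ =>
        memLp_one_iff_integrable.1 (memLp_clip_sq (hξ k) (c n k) 1)
    have iD : Integrable (fun ω => |∑ k ∈ Finset.Icc 1 (m n), clip (c n k * ξ k ω) ^ 2 -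
        ∑ k ∈ Finset.Icc 1 (m n), weight μ (ξ 0) c n k|) μ :=
      (iY.sub (integrable_const _)).abs
    have e : ‖∑ k ∈ Finset.Icc 1 (m n), weight μ (ξ 0) c n k - 1‖ =
        ∫ _, ‖∑ k ∈ Finset.Icc 1 (m n), weight μ (ξ 0) c n k - 1‖ ∂μ := by simp
    rw [e, ← integral_add iD (integrable_const _)]
    exact integral_mono (iY.sub (integrable_const _)).abs (iD.add (integrable_const _))
      fun ω => abs_sub_le _ _ _
  have h5 := ((h1.const_mul (|t| + |t| * Real.exp (2 * t ^ 2))).add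
    (h2.const_mul (4 * |t| ^ 3))).add (h4.const_mul (2 + Real.exp (2 * t ^ 2) * t ^ 2))
  simp only [mul_zero, add_zero] at h5
  exact squeeze_zero (fun _ => norm_nonneg _)
    (fun n => norm_charFun_sub_le h_mds (c n) t (m n)) h5

end TriangularArray

end WeightedCLT

end

theorem mainTheorem8 {Ω : Type*} {mΩ : MeasurableSpace Ω} (μ : Measure Ω)
    [IsProbabilityMeasure μ] (ℱ : Filtration ℤ mΩ) (ξ : ℤ → Ω → ℝ)
    (h_mds : WeightedCLT.IsMartingaleDiff μ ℱ ξ)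
    (h_ident : ∀ k, IdentDistrib (ξ k) (ξ 0) μ μ)
    (h_inf : ∫⁻ ω, ENNReal.ofReal (ξ 0 ω ^ 2) ∂μ = ⊤)
    (h_slow : WeightedCLT.SlowlyVarying (WeightedCLT.truncMoment μ (ξ 0)))
    (m : ℕ → ℕ) (c : ℕ → ℕ → ℝ)
    (h_sup : BddAbove (Set.range fun n =>
      ∑ k ∈ Finset.Icc 1 (m n), WeightedCLT.weight μ (ξ 0) c n k))
    (h_max : Tendsto (fun n => ⨆ k : Finset.Icc 1 (m n), WeightedCLT.weight μ (ξ 0) c n k)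
      atTop (𝓝 0))
    (h_mix : WeightedCLT.CondM1 μ ξ ∨ WeightedCLT.CondM2 μ ξ) :
    TendstoInMeasure μ
      (fun n ω => (∑ k ∈ Finset.Icc 1 (m n), c n k ^ 2 * ξ k ω ^ 2)
        - (∑ k ∈ Finset.Icc 1 (m n), WeightedCLT.weight μ (ξ 0) c n k))
      atTop (fun _ => (0 : ℝ)) ∧
    (Tendsto (fun n => ∑ k ∈ Finset.Icc 1 (m n), WeightedCLT.weight μ (ξ 0) c n k)
        atTop (𝓝 1) →
      TendstoInMeasure μ (fun n ω => ∑ k ∈ Finset.Icc 1 (m n), c n k ^ 2 * ξ k ω ^ 2)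
        atTop (fun _ => (1 : ℝ)) ∧
      TendstoInDistribution (fun n ω => ∑ k ∈ Finset.Icc 1 (m n), c n k * ξ k ω)
        atTop (id : ℝ → ℝ) (fun _ => μ) (gaussianReal 0 1)) := by
  have hξ k : Measurable (ξ k) := (h_mds.adapted k).mono (ℱ.le k) le_rfl
  have h := WeightedCLT.tendstoInMeasure_sum_sq_sub hξ h_mds.integrable h_ident h_inf h_slow
    h_sup h_max h_mix
  exact ⟨h, fun h_one => ⟨WeightedCLT.tendstoInMeasure_of_sub_of_tendsto h h_one,
    WeightedCLT.tendstoInDistribution_sum h_ident h_inf h_slow h_sup h_max h_mds h_mix h_one⟩⟩
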